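/- Let $N\ge 1$ and let $k<0$ be integers, and let $\chi$ be a Dirichlet character modulo $N$ with $\chi(-1)=(-1)^k$. For $g=\left(\begin{smallmatrix}a&b\\c&d\end{smallmatrix}\right)\in\Gamma_0(N)$ put $\chi(g)=\chi(d)$. Write $\tau=u+iv$ for a point of the upper half-plane $\mathbb H$, $j\left(\left(\begin{smallmatrix}a&b\\c&d\end{smallmatrix}\right),\tau\right)=c\tau+d$, and $(f|_k\gamma)(\tau)=j(\gamma,\tau)^{-k}f(\gamma\tau)$ for $\gamma\in\mathrm{SL}_2(\mathbb Z)$. For a cusp $\rho$ of $\Gamma_0(N)$ choose $\gamma_\rho\in\mathrm{SL}_2(\mathbb Z)$ with $\gamma_\rho(i\infty)=\rho$, and let $\Gamma_\rho=\Gamma_0(N)\cap\gamma_\rho\Gamma_\infty\gamma_\rho^{-1}$, where $\Gamma_\infty$ is the stabilizer of $i\infty$ in $\mathrm{SL}_2(\mathbb Z)$. We say that $\chi$ is trivial at $\rho$ if $\chi(g)=1$ for every $g\in\Gamma_\rho$ such that $\gamma_\rho^{-1}g\gamma_\rho=\left(\begin{smallmatrix}1&n\\0&1\end{smallmatrix}\right)$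 for some $n\in\mathbb Z$. For such $\rho$ set $$\mathcal F_{k,\rho}(N,\chi;\tau)=\sum_{g\in\Gamma_\rho\backslash\Gamma_0(N)}\overline{\chi(g)}\,\Big(\tfrac{v^{1-k}}{1-k}\Big)\Big|_k\gamma_\rho^{-1}g\,(\tau),\qquad E_{2-k,\rho}(N,\overline\chi;\tau)=\sum_{g\in\Gamma_\rho\backslash\Gamma_0(N)}\chi(g)\,j(\gamma_\rho^{-1}g,\tau)^{k-2}.$$ Let $\mathcal E_k^{\#}(N,\chi)$ and $\mathcal E_{2-k}(N,\overline\chi)$ be the $\mathbb C$-spans of the functions $\mathcal F_{k,\rho}(N,\chi;\cdot)$ and $E_{2-k,\rho}(N,\overline\chi;\cdot)$ respectively, where $\rho$ runs over the cusps of $\Gamma_0(N)$ at which $\chi$ is trivial. Let $\xi_k=2iv^k\,\overline{\frac{\partial}{\partial\bar\tau}}$ be the shadow operator, that is, $\xi_kf=2iv^k\,\overline{\partial f/\partial\bar\tau}$ with $\frac{\partial}{\partial\bar\tau}=\frac12\left(\frac{\partial}{\partial u}+i\frac{\partial}{\partial v}\right)$. Then the series above converge absolutely at every $\tau\in\mathbb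 H$, every element of $\mathcal E_k^{\#}(N,\chi)$ is a smooth function of $(u,v)$, and the restriction of $\xi_k$ to $\mathcal E_k^{\#}(N,\chi)$ is a (conjugate-linear) isomorphism from $\mathcal E_k^{\#}(N,\chi)$ onto $\mathcal E_{2-k}(N,\overline\chi)$. Moreover, $\mathcal E_k^{\#}(N,\chi)$ is finite-dimensional and $$\dim_{\mathbb C}\mathcal E_k^{\#}(N,\chi)=\sum_{\substack{C\mid N\\ \gcd(C,N/C)\,\mid\,N/m_{\overline\chi}}}\phi(\gcd(C,N/C)),$$ where $m_{\overline\chi}$ is the conductor of $\overline\chi$ and $\phi$ is Euler's function. -/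

import Mathlib

open scoped MatrixGroups ModularForm ContDiff

noncomputable section

namespace HarmonicMaass

open UpperHalfPlane CongruenceSubgroup

/-- The stabilizer of the cusp `i∞` in `SL(2, ℤ)`: the matrices with lower left entry `0`. -/
def stabInfty : Subgroup SL(2, ℤ) where
  carrier := {h | h 1 0 = 0}
  one_mem' := by simp
  mul_mem' := by
    intro a b ha hb
    change a 1 0 = 0 at ha
    change b 1 0 = 0 at hb
    change (a * b) 1 0 = 0
    simp [Matrix.SpecialLinearGroup.coe_mul, Matrix.mul_apply, Fin.sum_univ_two, ha, hb]
  inv_mem' := by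
    intro a ha
    change a 1 0 = 0 at ha
    change a⁻¹ 1 0 = 0
    simp [Matrix.SpecialLinearGroup.SL2_inv_expl, ha]

/-- The stabilizer in `Γ₀(N)` of the cusp `ρ = γ(i∞)`, that is `Γ_ρ = Γ₀(N) ∩ γ Γ_∞ γ⁻¹`. Every cusp
of `Γ₀(N)` is of the form `γ(i∞)` with `γ ∈ SL(2, ℤ)`, so cusps are given by such a `γ = γ_ρ`. -/
def cuspStabilizer (N : ℕ) (γ : SL(2, ℤ)) : Subgroup (Gamma0 N) :=
  (stabInfty.map (MulAut.conj γ).toMonoidHom).subgroupOf (Gamma0 N)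

/-- The set `Γ_ρ \ Γ₀(N)` of cosets `Γ_ρ g`, for the cusp `ρ = γ(i∞)`. -/
abbrev CuspCosets (N : ℕ) (γ : SL(2, ℤ)) : Type :=
  Quotient (QuotientGroup.rightRel (cuspStabilizer N γ))

/-- The value `χ(g) = χ(d)` of a Dirichlet character at `g = (a b; c d) ∈ Γ₀(N)`. -/
def charValue {N : ℕ} (χ : DirichletCharacter ℂ N) (g : Gamma0 N) : ℂ :=
  χ (Gamma0Map N g)

/-- The complex conjugate character `χ̄`. -/
def conjChar {N : ℕ} (χ : DirichletCharacter ℂ N) : DirichletCharacter ℂ N :=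
  χ.ringHomComp (starRingEnd ℂ)

/-- `χ` is trivial at the cusp `ρ = γ(i∞)`: one has `χ(g) = 1` for every `g ∈ Γ_ρ` such that
`γ⁻¹ g γ` is a translation `(1 n; 0 1)`; equivalently, the cusp parameter of `ρ` is `0`.
(The group `Γ_ρ` is generated by these `g` and by `-1`, at which `χ` has the value `(-1)^k`.) -/
def TrivialAtCusp {N : ℕ} (χ : DirichletCharacter ℂ N) (γ : SL(2, ℤ)) : Prop :=
  ∀ g : Gamma0 N, (∃ n : ℤ, γ⁻¹ * (g : SL(2, ℤ)) * γ = ModularGroup.T ^ n) → charValue χ g = 1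

/-- The term `conj χ(g) * j(γ⁻¹ g, τ) ^ (-w)` of the Eisenstein series of weight `w`, where
`j((a b; c d), τ) = c τ + d`. -/
def eisensteinTerm {N : ℕ} (χ : DirichletCharacter ℂ N) (w : ℤ) (γ : SL(2, ℤ)) (τ : ℍ)
    (g : Gamma0 N) : ℂ :=
  starRingEnd ℂ (charValue χ g) * denom ((γ⁻¹ * (g : SL(2, ℤ)) : SL(2, ℤ)) : GL (Fin 2) ℝ) τ ^ (-w)

/-- The function `τ = u + i v ↦ v ^ (1 - k) / (1 - k)`. -/
def seed (k : ℤ) (τ : ℍ) : ℂ :=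
  (τ.im : ℂ) ^ (1 - k) / (1 - k)

/-- The term `conj χ(g) * ((v ^ (1 - k) / (1 - k)) ∣ₖ γ⁻¹ g) (τ)` of the series `𝓕_{k,ρ}`. -/
def maassTerm {N : ℕ} (χ : DirichletCharacter ℂ N) (k : ℤ) (γ : SL(2, ℤ)) (τ : ℍ)
    (g : Gamma0 N) : ℂ :=
  starRingEnd ℂ (charValue χ g) * (seed k ∣[k] (γ⁻¹ * (g : SL(2, ℤ)))) τ

/-- The Eisenstein series
`E_{w,ρ}(N, χ; τ) = ∑_{g ∈ Γ_ρ \ Γ₀(N)} conj χ(g) j(γ_ρ⁻¹ g, τ) ^ (-w)` at the cusp `ρ = γ(i∞)`.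
If `χ(-1) = (-1)^w` and `χ` is trivial at `ρ`, the terms depend only on the coset of `g`; they are
evaluated at an arbitrary representative. -/
def eisenstein {N : ℕ} (χ : DirichletCharacter ℂ N) (w : ℤ) (γ : SL(2, ℤ)) (τ : ℍ) : ℂ :=
  ∑' c : CuspCosets N γ, eisensteinTerm χ w γ τ c.out

/-- The series `𝓕_{k,ρ}(N, χ; τ) = ∑_{g ∈ Γ_ρ \ Γ₀(N)} conj χ(g) ((v ^ (1-k) / (1-k)) ∣ₖ γ_ρ⁻¹ g) (τ)`
at the cusp `ρ = γ(i∞)`. If `χ(-1) = (-1)^k` and `χ` is trivial at `ρ`, the terms depend only on the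
coset of `g`; they are evaluated at an arbitrary representative. -/
def maassSeries {N : ℕ} (χ : DirichletCharacter ℂ N) (k : ℤ) (γ : SL(2, ℤ)) (τ : ℍ) : ℂ :=
  ∑' c : CuspCosets N γ, maassTerm χ k γ τ c.out

/-- The Eisenstein space `𝓔_w(N, χ)`: the complex span of the Eisenstein series at the cusps of
`Γ₀(N)` at which `χ` is trivial. (Another choice of `γ` for the same or an equivalent cusp multiplies
the series by a constant of absolute value `1`.) -/
def eisensteinSpace {N : ℕ} (χ : DirichletCharacter ℂ N) (w : ℤ) : Submodule ℂ (ℍ → ℂ) :=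
  Submodule.span ℂ {f | ∃ γ : SL(2, ℤ), TrivialAtCusp χ γ ∧ f = eisenstein χ w γ}

/-- The space `𝓔_k^#(N, χ)`: the complex span of the functions `𝓕_{k,ρ}(N, χ; ·)` at the cusps of
`Γ₀(N)` at which `χ` is trivial. -/
def maassSpace {N : ℕ} (χ : DirichletCharacter ℂ N) (k : ℤ) : Submodule ℂ (ℍ → ℂ) :=
  Submodule.span ℂ {f | ∃ γ : SL(2, ℤ), TrivialAtCusp χ γ ∧ f = maassSeries χ k γ}

/-- `f : ℍ → ℂ` is smooth as a function of the real variables `u, v`, `τ = u + i v`. -/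
def Smooth (f : ℍ → ℂ) : Prop :=
  ContDiffOn ℝ ∞ (f ∘ ofComplex) {z : ℂ | 0 < z.im}

/-- The Wirtinger derivative `∂f/∂τ̄ = (∂f/∂u + i ∂f/∂v) / 2`. -/
def dbar (f : ℍ → ℂ) (τ : ℍ) : ℂ :=
  (fderiv ℝ (f ∘ ofComplex) τ 1 + Complex.I * fderiv ℝ (f ∘ ofComplex) τ Complex.I) / 2

/-- The shadow operator `ξ_k f = 2 i v^k conj(∂f/∂τ̄)`. -/
def shadow (k : ℤ) (f : ℍ → ℂ) (τ : ℍ) : ℂ :=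
  2 * Complex.I * (τ.im : ℂ) ^ k * starRingEnd ℂ (dbar f τ)


end HarmonicMaass

end

/-! Put k = -m and l = cτ + d. A matrix with lower row (c, d) turns the seed into v^(m+1)/(m+1) ·
l⁻¹ · l̄^(-(m+1)) (`seed_slash`). So each 𝓕_ρ is a power of v times a lattice series over distinct
integer rows, of total exponent m + 2 ≥ 3. This gives absolute convergence, and termwise
differentiation to every order gives smoothness (`contDiffOn_biSeries`). Since v c = (i/2)(l̄ - l),
the ∂/∂τ̄ derivative of each term collapses to a multiple of v^m l̄^(-(m+2)), so ξ_k sends 𝓕_ρ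
exactly to E_ρ (`biSeries_antiderivative`, `shadow_maassSeries`). Surjectivity follows on
generators.

Injectivity and the dimension come from the Eisenstein side. Slashed by δ and followed up the
imaginary axis, E_ρ tends to a value that is nonzero at its own cusp and zero at every inequivalent
one, so the E_ρ at inequivalent cusps are independent (`linearIndependent_eisenstein`), and this
pulls back through ξ_k. Equivalent cusps give proportional 𝓕_ρ (`maassSeries_equivalent`), so one
series per class forms a basis. The classes are labelled by C ∣ N and a unit modulo gcd(C, N/C)
(`exists_equivalent`, `eq_of_equivalent`), and `trivialAtCusp_iff` selects the C that occur in the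
sum. -/

noncomputable section

namespace HarmonicMaass

open UpperHalfPlane CongruenceSubgroup Filter Topology

/-! ### Lattice series: convergence and termwise differentiation -/

/-- The linear form `z ↦ c z + d` attached to an integer vector `(c, d)`. -/
def linForm (x : Fin 2 → ℤ) (z : ℂ) : ℂ := x 0 * z + x 1

/-- The real-analytic lattice series `∑ εᵢ (cᵢ z + dᵢ)^(-a) conj(cᵢ z + dᵢ)^(-b)`. -/
def biSeries {ι : Type*} (x : ι → Fin 2 → ℤ) (ε : ι → ℂ) (a b : ℕ) (z : ℂ) : ℂ :=
  ∑' i, ε i * ((linForm (x i) z)⁻¹ ^ a * (starRingEnd ℂ (linForm (x i) z))⁻¹ ^ b)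

/-- An open half strip of the upper half-plane. -/
def halfStrip (A B : ℝ) : Set ℂ := {z | |z.re| < A ∧ B < z.im}

lemma isOpen_halfStrip (A B : ℝ) : IsOpen (halfStrip A B) :=
  (isOpen_lt (Complex.continuous_re.abs) continuous_const).inter
    (isOpen_lt continuous_const Complex.continuous_im)

lemma isPreconnected_halfStrip (A B : ℝ) : IsPreconnected (halfStrip A B) := by
  refine Convex.isPreconnected ?_
  have h1 : halfStrip A B = Complex.re ⁻¹' (Set.Ioo (-A) A) ∩ Complex.im ⁻¹' (Set.Ioi B) := by
    ext z; simp [halfStrip, abs_lt]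
  rw [h1]
  exact ((convex_Ioo _ _).is_linear_preimage Complex.reLm.isLinear).inter
    ((convex_Ioi _).is_linear_preimage Complex.imLm.isLinear)

lemma mem_halfStrip {z : ℂ} (hz : 0 < z.im) : z ∈ halfStrip (|z.re| + 1) (z.im / 2) :=
  ⟨by simp, by linarith⟩

/-- One constant serves the whole strip, which makes the majorants below independent of z. -/
lemma exists_linForm_lower_bound (A : ℝ) {B : ℝ} (hB : 0 < B) :
    ∃ r : ℝ, 0 < r ∧ ∀ z ∈ halfStrip A B, ∀ x : Fin 2 → ℤ, r * ‖x‖ ≤ ‖linForm x z‖ := by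
  refine ⟨_, EisensteinSeries.r_pos ⟨⟨A, B⟩, hB⟩, fun z hz x => ?_⟩
  rcases eq_or_ne x 0 with rfl | hx
  · simp
  have hz0 : 0 < z.im := hB.trans hz.2
  refine le_trans ?_ (EisensteinSeries.r_mul_max_le ⟨z, hz0⟩ hx)
  gcongr
  exact EisensteinSeries.r_lower_bound_on_verticalStrip ⟨z, hz0⟩ hB ⟨hz.1.le, hz.2.le⟩

lemma norm_biTerm_le {r : ℝ} (hr : 0 < r) {x : Fin 2 → ℤ} (hx : x ≠ 0) {z : ℂ}
    (hz : r * ‖x‖ ≤ ‖linForm x z‖) (ε : ℂ) (a b : ℕ) :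
    ‖ε * ((linForm x z)⁻¹ ^ a * (starRingEnd ℂ (linForm x z))⁻¹ ^ b)‖ ≤
      r⁻¹ ^ (a + b) * (‖ε‖ * ‖x‖⁻¹ ^ (a + b)) := by
  have hx' : 0 < ‖x‖ := norm_pos_iff.2 hx
  have h : ‖linForm x z‖⁻¹ ≤ r⁻¹ * ‖x‖⁻¹ := by
    rw [← mul_inv]
    exact inv_anti₀ (by positivity) hz
  rw [norm_mul, norm_mul, norm_pow, norm_pow, norm_inv, norm_inv, RCLike.norm_conj, ← pow_add]
  calc ‖ε‖ * ‖linForm x z‖⁻¹ ^ (a + b) ≤ ‖ε‖ * (r⁻¹ * ‖x‖⁻¹) ^ (a + b) := by gcongr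
    _ = _ := by ring

lemma summable_biSeries {ι : Type*} {x : ι → Fin 2 → ℤ} (hx : ∀ i, x i ≠ 0) {ε : ι → ℂ} {a b : ℕ}
    (h : Summable fun i => ‖ε i‖ * ‖x i‖⁻¹ ^ (a + b)) {z : ℂ} (hz : 0 < z.im) :
    Summable fun i => ε i * ((linForm (x i) z)⁻¹ ^ a * (starRingEnd ℂ (linForm (x i) z))⁻¹ ^ b) := by
  obtain ⟨r, hr, H⟩ := exists_linForm_lower_bound (|z.re| + 1) (half_pos hz)
  exact Summable.of_norm_bounded (h.mul_left (r⁻¹ ^ (a + b)))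
    fun i => norm_biTerm_le hr (hx i) (H z (mem_halfStrip hz) (x i)) _ _ _

/-- Differentiation costs a factor c, at most ‖x‖, and raises the exponent by one. The weighted
summability condition is therefore stable, and derivatives can be iterated. -/
lemma summable_biSeries_deriv {ι : Type*} {x : ι → Fin 2 → ℤ} (hx : ∀ i, x i ≠ 0) {ε : ι → ℂ}
    {n : ℕ} (h : Summable fun i => ‖ε i‖ * ‖x i‖⁻¹ ^ n) (t : ℂ) :
    Summable fun i => ‖t * ε i * (x i 0 : ℂ)‖ * ‖x i‖⁻¹ ^ (n + 1) := by
  refine Summable.of_nonneg_of_le (fun i => by positivity) (fun i => ?_) (h.mul_left ‖t‖)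
  have hx' : 0 < ‖x i‖ := norm_pos_iff.2 (hx i)
  have h0 : ‖(x i 0 : ℂ)‖ ≤ ‖x i‖ := by
    have := norm_le_pi_norm (x i) 0
    simpa [Int.norm_eq_abs] using this
  rw [norm_mul, norm_mul, pow_succ]
  calc ‖t‖ * ‖ε i‖ * ‖(x i 0 : ℂ)‖ * (‖x i‖⁻¹ ^ n * ‖x i‖⁻¹)
      ≤ ‖t‖ * ‖ε i‖ * ‖x i‖ * (‖x i‖⁻¹ ^ n * ‖x i‖⁻¹) := by gcongr
    _ = _ := by field_simp

/-- The coefficients of the identity and of conjugation are the derivatives ∂/∂z and ∂/∂z̄. -/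
lemma hasFDerivAt_biTerm {x : Fin 2 → ℤ} {z : ℂ} (hz : linForm x z ≠ 0) (ε : ℂ) (a b : ℕ) :
    HasFDerivAt (𝕜 := ℝ)
      (fun z => ε * ((linForm x z)⁻¹ ^ a * (starRingEnd ℂ (linForm x z))⁻¹ ^ b))
      ((-a * ε * x 0 * ((linForm x z)⁻¹ ^ (a + 1) * (starRingEnd ℂ (linForm x z))⁻¹ ^ b)) •
          ContinuousLinearMap.id ℝ ℂ +
        (-b * ε * x 0 * ((linForm x z)⁻¹ ^ a * (starRingEnd ℂ (linForm x z))⁻¹ ^ (b + 1))) •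
          (Complex.conjCLE : ℂ →L[ℝ] ℂ)) z := by
  have hl : HasDerivAt (linForm x) (x 0) z := by
    simpa only [mul_one] using! ((hasDerivAt_id z).const_mul (x 0 : ℂ)).add_const (x 1 : ℂ)
  have hp (n : ℕ) : HasDerivAt (fun z => (linForm x z)⁻¹ ^ n)
      (-n * x 0 * (linForm x z)⁻¹ ^ (n + 1)) z := by
    refine ((hl.inv hz).pow n).congr_deriv ?_
    rcases n with _ | n
    · simp
    · simp only [Nat.add_sub_cancel, Pi.inv_apply]
      rw [div_eq_mul_inv, ← inv_pow]
      ring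
  have ha := (hp a).hasFDerivAt.restrictScalars ℝ
  have hb := (Complex.conjCLE : ℂ →L[ℝ] ℂ).hasFDerivAt.comp z
    ((hp b).hasFDerivAt.restrictScalars ℝ)
  have h := (ha.mul hb).const_mul ε
  refine (h.congr_fderiv ?_).congr_of_eventuallyEq (Filter.Eventually.of_forall fun w => ?_)
  · ext w
    simp
    ring
  · simp

/-- The Wirtinger derivatives of the lattice series are lattice series. -/
lemma hasFDerivAt_biSeries {ι : Type*} {x : ι → Fin 2 → ℤ} (hx : ∀ i, x i ≠ 0) {ε : ι → ℂ}
    {a b : ℕ} (h : Summable fun i => ‖ε i‖ * ‖x i‖⁻¹ ^ (a + b)) {z : ℂ} (hz : 0 < z.im) :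
    HasFDerivAt (𝕜 := ℝ) (biSeries x ε a b)
      (biSeries x (fun i => -a * ε i * x i 0) (a + 1) b z • ContinuousLinearMap.id ℝ ℂ +
        biSeries x (fun i => -b * ε i * x i 0) a (b + 1) z • (Complex.conjCLE : ℂ →L[ℝ] ℂ)) z := by
  obtain ⟨r, hr, H⟩ := exists_linForm_lower_bound (|z.re| + 1) (half_pos hz)
  have ha := summable_biSeries_deriv hx h (-a)
  have hb := summable_biSeries_deriv hx h (-b)
  have hne (i) {w : ℂ} (hw : w ∈ halfStrip (|z.re| + 1) (z.im / 2)) : linForm (x i) w ≠ 0 := by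
    have := (mul_pos hr (norm_pos_iff.2 (hx i))).trans_le (H w hw (x i))
    exact norm_pos_iff.1 this
  have key := hasFDerivAt_tsum_of_isPreconnected (𝕜 := ℝ)
    ((ha.mul_left (r⁻¹ ^ (a + b + 1) * ‖ContinuousLinearMap.id ℝ ℂ‖)).add
      (hb.mul_left (r⁻¹ ^ (a + b + 1) * ‖(Complex.conjCLE : ℂ →L[ℝ] ℂ)‖)))
    (isOpen_halfStrip _ _) (isPreconnected_halfStrip (|z.re| + 1) (z.im / 2))
    (fun i w hw => hasFDerivAt_biTerm (hne i hw) (ε i) a b)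
    (fun i w hw => ?_) (mem_halfStrip hz) (summable_biSeries hx h hz) (mem_halfStrip hz)
  · refine key.congr_fderiv ?_
    have sa := summable_biSeries (a := a + 1) (b := b) hx (by convert ha using 3; ring) hz
    have sb := summable_biSeries (a := a) (b := b + 1) hx hb hz
    rw [Summable.tsum_add (sa.smul_const _) (sb.smul_const _), sa.tsum_smul_const,
      sb.tsum_smul_const]
    rfl
  · have h1 := norm_biTerm_le hr (hx i) (H w hw (x i)) (-a * ε i * x i 0) (a + 1) b
    have h2 := norm_biTerm_le hr (hx i) (H w hw (x i)) (-b * ε i * x i 0) a (b + 1)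
    rw [show a + 1 + b = a + b + 1 by ring] at h1
    rw [← add_assoc] at h2
    refine (norm_add_le _ _).trans ?_
    rw [norm_smul, norm_smul]
    refine (add_le_add (mul_le_mul_of_nonneg_right h1 (norm_nonneg _))
      (mul_le_mul_of_nonneg_right h2 (norm_nonneg _))).trans (le_of_eq ?_)
    ring

lemma isOpen_upper : IsOpen {z : ℂ | 0 < z.im} :=
  isOpen_lt continuous_const Complex.continuous_im

/-- Induction on the order, for all coefficients and exponents at once: the derivative is built from
two series of the same kind. -/
lemma contDiffOn_biSeries {ι : Type*} {x : ι → Fin 2 → ℤ} (hx : ∀ i, x i ≠ 0) {ε : ι → ℂ}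
    {a b : ℕ} (h : Summable fun i => ‖ε i‖ * ‖x i‖⁻¹ ^ (a + b)) :
    ContDiffOn ℝ ∞ (biSeries x ε a b) {z : ℂ | 0 < z.im} := by
  refine contDiffOn_infty.2 fun n => ?_
  induction n generalizing ε a b with
  | zero =>
    exact contDiffOn_zero.2
      fun z hz => (hasFDerivAt_biSeries hx h hz).continuousAt.continuousWithinAt
  | succ n ih =>
    push_cast
    refine (contDiffOn_succ_iff_fderiv_of_isOpen isOpen_upper).2 ⟨fun z hz =>
      (hasFDerivAt_biSeries hx h hz).differentiableAt.differentiableWithinAt, by simp, ?_⟩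
    have ha := ih (a := a + 1) (b := b) (ε := fun i => -a * ε i * x i 0)
      (by convert summable_biSeries_deriv hx h (-a) using 3; ring)
    have hb := ih (a := a) (b := b + 1) (ε := fun i => -b * ε i * x i 0)
      (summable_biSeries_deriv hx h (-b))
    exact ((ha.smul contDiffOn_const).add (hb.smul contDiffOn_const)).congr
      fun z hz => (hasFDerivAt_biSeries hx h hz).fderiv

/-! ### Lower rows, the slashed seed and cusp stabilizers -/

lemma denom_eq_linForm (h : SL(2, ℤ)) (z : ℂ) :
    denom (h : GL (Fin 2) ℝ) z = linForm (h.1 1) z := by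
  simp [denom, linForm]

lemma row_ne_zero (h : SL(2, ℤ)) : h.1 1 ≠ 0 := by
  intro h0
  have h1 := h.det_coe
  rw [Matrix.det_fin_two] at h1
  simp [h0] at h1

lemma linForm_row_ne_zero (h : SL(2, ℤ)) {z : ℂ} (hz : 0 < z.im) : linForm (h.1 1) z ≠ 0 := by
  rw [← denom_eq_linForm]
  exact denom_ne_zero (h : GL (Fin 2) ℝ) ⟨z, hz⟩

lemma linForm_smul (n : ℤ) (x : Fin 2 → ℤ) (z : ℂ) : linForm (n • x) z = n * linForm x z := by
  simp [linForm]
  ring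

/-- The slash action on the seed `v ^ (1 - k) / (1 - k)`, for `k = -m`. -/
lemma seed_slash (m : ℕ) (h : SL(2, ℤ)) (τ : ℍ) :
    (seed (-m) ∣[-(m : ℤ)] h) τ = (τ.im : ℂ) ^ (m + 1) / (m + 1) *
      ((linForm (h.1 1) τ)⁻¹ ^ 1 * (starRingEnd ℂ (linForm (h.1 1) τ))⁻¹ ^ (m + 1)) := by
  have hl := linForm_row_ne_zero h τ.im_pos
  have hl' : starRingEnd ℂ (linForm (h.1 1) τ) ≠ 0 := (map_ne_zero _).2 hl
  rw [ModularForm.SL_slash_apply, seed, ModularGroup.im_smul_eq_div_normSq, denom_eq_linForm,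
    neg_neg, zpow_natCast, Complex.ofReal_div, Complex.normSq_eq_conj_mul_self,
    show (1 - -(m : ℤ)) = ((m + 1 : ℕ) : ℤ) by push_cast; ring, zpow_natCast]
  have hm : (m : ℂ) + 1 ≠ 0 := by exact_mod_cast m.succ_ne_zero
  generalize linForm (h.1 1) τ = z at *
  have e : (1 : ℂ) - ((-(m : ℤ) : ℤ) : ℂ) = m + 1 := by push_cast; ring
  rw [e, div_pow, mul_pow, inv_pow, inv_pow, pow_one]
  field_simp
  ring

lemma mem_cuspStabilizer {N : ℕ} {γ : SL(2, ℤ)} {g : Gamma0 N} :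
    g ∈ cuspStabilizer N γ ↔ (γ⁻¹ * (g : SL(2, ℤ)) * γ) 1 0 = 0 := by
  rw [cuspStabilizer, Subgroup.mem_subgroupOf, Subgroup.mem_map]
  constructor
  · rintro ⟨x, hx, hxg⟩
    rw [← hxg]
    change x 1 0 = 0 at hx
    simpa [mul_assoc] using hx
  · intro h
    exact ⟨_, h, by simp [mul_assoc]⟩

lemma mul_row_of_lower_zero {h : SL(2, ℤ)} (h0 : h 1 0 = 0) (x : SL(2, ℤ)) :
    (h * x).1 1 = h 1 1 • x.1 1 := by
  ext j
  simp [Matrix.SpecialLinearGroup.coe_mul, Matrix.mul_apply, Fin.sum_univ_two, h0]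

lemma diag_of_lower_zero {h : SL(2, ℤ)} (h0 : h 1 0 = 0) :
    (h 0 0 = 1 ∧ h 1 1 = 1) ∨ (h 0 0 = -1 ∧ h 1 1 = -1) := by
  have h1 := h.det_coe
  rw [Matrix.det_fin_two, h0, mul_zero, sub_zero] at h1
  exact Int.mul_eq_one_iff_eq_one_or_neg_one.1 h1

lemma eq_T_zpow {h : SL(2, ℤ)} (h0 : h 1 0 = 0) (h1 : h 1 1 = 1) :
    h = ModularGroup.T ^ (h 0 1) := by
  have h2 : h 0 0 = 1 := by
    rcases diag_of_lower_zero h0 with h | h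
    · exact h.1
    · omega
  ext i j
  rw [ModularGroup.coe_T_zpow]
  fin_cases i <;> fin_cases j <;> simp [h0, h1, h2]

/-! ### Values of χ on Γ₀(N) and on cusp stabilizers -/

section Character

variable {N : ℕ} (χ : DirichletCharacter ℂ N)

lemma charValue_mul (g h : Gamma0 N) : charValue χ (g * h) = charValue χ g * charValue χ h := by
  simp [charValue]

lemma charValue_one : charValue χ 1 = 1 := by
  simp [charValue]

lemma charValue_ne_zero (g : Gamma0 N) : charValue χ g ≠ 0 := by
  intro h
  have := charValue_mul χ g g⁻¹
  rw [mul_inv_cancel, charValue_one, h, zero_mul] at this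
  exact one_ne_zero this

lemma norm_charValue_le (g : Gamma0 N) : ‖charValue χ g‖ ≤ 1 :=
  DirichletCharacter.norm_le_one χ _

lemma charValue_conjChar (g : Gamma0 N) :
    charValue (conjChar χ) g = starRingEnd ℂ (charValue χ g) := rfl

variable {χ}

/-- On the stabilizer of a cusp at which `χ` is trivial, `χ(g) = ε ^ k`, where `ε = ±1` is the
diagonal entry of `γ⁻¹ g γ`. -/
lemma charValue_of_mem_cuspStabilizer {m : ℕ} (hχ : χ (-1) = (-1) ^ (-(m : ℤ))) {γ : SL(2, ℤ)}
    (hγ : TrivialAtCusp χ γ) {g : Gamma0 N} (hg : g ∈ cuspStabilizer N γ) :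
    charValue χ g = ((γ⁻¹ * (g : SL(2, ℤ)) * γ) 1 1 : ℂ) ^ m := by
  rw [mem_cuspStabilizer] at hg
  rcases diag_of_lower_zero hg with ⟨-, h⟩ | ⟨-, h⟩
  · rw [hγ g ⟨_, eq_T_zpow hg h⟩, h]
    simp
  -- Here -g is conjugate to a translation, so χ(-g) = 1, and the parity of χ gives χ(g).
  · have hneg : -(g : SL(2, ℤ)) ∈ Gamma0 N := by
      have := g.2
      rw [Gamma0_mem] at this ⊢
      simp [this]
    have e : γ⁻¹ * (-(g : SL(2, ℤ))) * γ = -(γ⁻¹ * (g : SL(2, ℤ)) * γ) := by simp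
    have h1 : charValue χ ⟨-(g : SL(2, ℤ)), hneg⟩ = 1 :=
      hγ _ ⟨_, by
        rw [e]
        refine eq_T_zpow ?_ ?_
        · rw [Matrix.SpecialLinearGroup.coe_neg, Matrix.neg_apply, hg, neg_zero]
        · rw [Matrix.SpecialLinearGroup.coe_neg, Matrix.neg_apply, h, neg_neg]⟩
    have h2 : charValue χ ⟨-(g : SL(2, ℤ)), hneg⟩ = χ (-1) * charValue χ g := by
      rw [charValue, charValue, ← map_mul]
      simp [Gamma0Map]
    rw [h2, hχ] at h1
    rw [h]
    have h3 : ((-1 : ℂ) ^ (-(m : ℤ))) * (-1) ^ m = 1 := by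
      rw [zpow_neg, zpow_natCast, inv_mul_cancel₀ (pow_ne_zero _ (by norm_num))]
    push_cast
    exact mul_left_cancel₀ (left_ne_zero_of_mul_eq_one h1) (h1.trans h3.symm)

end Character

/-! ### The two series as lattice series over lower rows -/

section Terms

variable {N : ℕ} {χ : DirichletCharacter ℂ N}

/-- The lower row of `γ⁻¹ g` for the chosen representative `g` of a coset. -/
def cosetRow {N : ℕ} {γ : SL(2, ℤ)} (c : CuspCosets N γ) : Fin 2 → ℤ :=
  (γ⁻¹ * (c.out : SL(2, ℤ))).1 1

lemma cosetRow_ne_zero {γ : SL(2, ℤ)} (c : CuspCosets N γ) : cosetRow c ≠ 0 := row_ne_zero _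

/-- The lower left entry of B A⁻¹ is, up to sign, the determinant of the two lower rows, so it
vanishes when they agree. -/
lemma cosetRow_injective {γ : SL(2, ℤ)} :
    Function.Injective (cosetRow : CuspCosets N γ → Fin 2 → ℤ) := by
  intro c c' h
  rw [← c.out_eq, ← c'.out_eq, Quotient.eq]
  rw [QuotientGroup.rightRel_apply, mem_cuspStabilizer]
  have e : γ⁻¹ * ((c'.out * c.out⁻¹ : Gamma0 N) : SL(2, ℤ)) * γ =
      (γ⁻¹ * (c'.out : SL(2, ℤ))) * (γ⁻¹ * (c.out : SL(2, ℤ)))⁻¹ := by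
    push_cast; group
  rw [e]
  simp only [cosetRow] at h
  generalize (γ⁻¹ * (c'.out : SL(2, ℤ))) = B at *
  generalize (γ⁻¹ * (c.out : SL(2, ℤ))) = A at *
  have h0 : A.1 1 0 = B.1 1 0 := congrFun h 0
  have h1 : A.1 1 1 = B.1 1 1 := congrFun h 1
  change (B * A⁻¹).1 1 0 = 0
  rw [Matrix.SpecialLinearGroup.coe_mul, Matrix.SpecialLinearGroup.SL2_inv_expl]
  rw [Matrix.mul_apply, Fin.sum_univ_two]
  change B.1 1 0 * A.1 1 1 + B.1 1 1 * -A.1 1 0 = 0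
  rw [h0, h1]
  ring

lemma summable_cosetRow {γ : SL(2, ℤ)} {n : ℕ} (hn : 3 ≤ n) :
    Summable fun c : CuspCosets N γ => ‖cosetRow c‖⁻¹ ^ n := by
  have h := EisensteinSeries.summable_one_div_norm_rpow (k := n) (by exact_mod_cast hn)
  refine (h.comp_injective (cosetRow_injective (N := N) (γ := γ))).congr fun c => ?_
  simp [Real.rpow_neg]

lemma summable_coeff_cosetRow {γ : SL(2, ℤ)} {n : ℕ} (hn : 3 ≤ n) {ε : CuspCosets N γ → ℂ}
    (hε : ∀ c, ‖ε c‖ ≤ 1) : Summable fun c => ‖ε c‖ * ‖cosetRow c‖⁻¹ ^ n :=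
  (summable_cosetRow hn).of_nonneg_of_le (fun c => by positivity)
    fun c => mul_le_of_le_one_left (by positivity) (hε c)

lemma maassTerm_eq (m : ℕ) (γ : SL(2, ℤ)) (τ : ℍ) (g : Gamma0 N) :
    maassTerm χ (-m) γ τ g = (τ.im : ℂ) ^ (m + 1) / (m + 1) * (starRingEnd ℂ (charValue χ g) *
      ((linForm ((γ⁻¹ * (g : SL(2, ℤ))).1 1) τ)⁻¹ ^ 1 *
        (starRingEnd ℂ (linForm ((γ⁻¹ * (g : SL(2, ℤ))).1 1) τ))⁻¹ ^ (m + 1))) := by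
  rw [maassTerm, seed_slash]
  ring

lemma eisensteinTerm_eq (m : ℕ) (γ : SL(2, ℤ)) (τ : ℍ) (g : Gamma0 N) :
    eisensteinTerm (conjChar χ) (2 - (-m)) γ τ g =
      charValue χ g * (linForm ((γ⁻¹ * (g : SL(2, ℤ))).1 1) τ)⁻¹ ^ (m + 2) := by
  rw [eisensteinTerm, charValue_conjChar, Complex.conj_conj, denom_eq_linForm, zpow_neg,
    show (2 - -(m : ℤ)) = ((m + 2 : ℕ) : ℤ) by push_cast; ring, zpow_natCast, inv_pow]

lemma summable_maass {m : ℕ} (hm : 0 < m) (γ : SL(2, ℤ)) {z : ℂ} (hz : 0 < z.im) :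
    Summable fun c : CuspCosets N γ => starRingEnd ℂ (charValue χ c.out) *
      ((linForm (cosetRow c) z)⁻¹ ^ 1 * (starRingEnd ℂ (linForm (cosetRow c) z))⁻¹ ^ (m + 1)) :=
  summable_biSeries cosetRow_ne_zero (summable_coeff_cosetRow (by omega)
    fun c => by simpa using norm_charValue_le χ c.out) hz

lemma maassSeries_eq (m : ℕ) (γ : SL(2, ℤ)) (τ : ℍ) :
    maassSeries χ (-m) γ τ = (τ.im : ℂ) ^ (m + 1) / (m + 1) *
      biSeries (cosetRow : CuspCosets N γ → _) (fun c => starRingEnd ℂ (charValue χ c.out))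
        1 (m + 1) τ := by
  rw [maassSeries, biSeries, ← tsum_mul_left]
  exact tsum_congr fun c => maassTerm_eq m γ τ c.out

lemma eisenstein_eq (m : ℕ) (γ : SL(2, ℤ)) (τ : ℍ) :
    eisenstein (conjChar χ) (2 - (-m)) γ τ =
      ∑' c : CuspCosets N γ, charValue χ c.out * (linForm (cosetRow c) τ)⁻¹ ^ (m + 2) :=
  tsum_congr fun c => eisensteinTerm_eq m γ τ c.out

lemma summable_eisenstein {m : ℕ} (hm : 0 < m) (γ : SL(2, ℤ)) {z : ℂ} (hz : 0 < z.im) :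
    Summable fun c : CuspCosets N γ =>
      charValue χ c.out * (linForm (cosetRow c) z)⁻¹ ^ (m + 2) := by
  have := summable_biSeries (a := m + 2) (b := 0) (x := (cosetRow : CuspCosets N γ → _))
    cosetRow_ne_zero (summable_coeff_cosetRow (by omega) fun c => norm_charValue_le χ c.out) hz
  simpa using this

end Terms

variable {N : ℕ} {χ : DirichletCharacter ℂ N}

/-! ### Independence of representatives and equivalent cusps -/

section Cosets

variable {m : ℕ} {γ : SL(2, ℤ)}

/-- With ε = ±1 the diagonal entry of γ⁻¹ s γ, the row scales by ε and the lattice term by ε^(m+2),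
while χ(s) contributes ε^m; the signs cancel. -/
lemma maassTerm_mul_left (hχ : χ (-1) = (-1) ^ (-(m : ℤ))) (hγ : TrivialAtCusp χ γ)
    {s : Gamma0 N} (hs : s ∈ cuspStabilizer N γ) (τ : ℍ) (g : Gamma0 N) :
    maassTerm χ (-m) γ τ (s * g) = maassTerm χ (-m) γ τ g := by
  have h1 := charValue_of_mem_cuspStabilizer hχ hγ hs
  rw [mem_cuspStabilizer] at hs
  have e : γ⁻¹ * ((s * g : Gamma0 N) : SL(2, ℤ)) =
      (γ⁻¹ * (s : SL(2, ℤ)) * γ) * (γ⁻¹ * (g : SL(2, ℤ))) := by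
    push_cast; group
  rw [maassTerm_eq, maassTerm_eq, e, mul_row_of_lower_zero hs, linForm_smul, charValue_mul, h1]
  rcases diag_of_lower_zero hs with ⟨-, h⟩ | ⟨-, h⟩
  · simp [h]
  · have h2 : ((-1 : ℂ) ^ m) * (-1) ^ m = 1 := by
      rw [← mul_pow]; simp
    rw [h]
    simp only [Int.cast_neg, Int.cast_one, map_mul, map_pow, map_neg, map_one, mul_inv, mul_pow,
      inv_neg, inv_one, pow_succ]
    linear_combination (τ.im : ℂ) ^ m * τ.im / (m + 1) * (starRingEnd ℂ (charValue χ g) *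
      ((linForm ((γ⁻¹ * (g : SL(2, ℤ))).1 1) τ)⁻¹ *
        ((starRingEnd ℂ (linForm ((γ⁻¹ * (g : SL(2, ℤ))).1 1) τ))⁻¹ ^ m *
          (starRingEnd ℂ (linForm ((γ⁻¹ * (g : SL(2, ℤ))).1 1) τ))⁻¹))) * h2

lemma maassTerm_out (hχ : χ (-1) = (-1) ^ (-(m : ℤ))) (hγ : TrivialAtCusp χ γ) (τ : ℍ)
    (g : Gamma0 N) :
    maassTerm χ (-m) γ τ (Quotient.out (Quotient.mk'' g : CuspCosets N γ)) =
      maassTerm χ (-m) γ τ g := by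
  set c : CuspCosets N γ := Quotient.mk'' g
  have h : (QuotientGroup.rightRel (cuspStabilizer N γ)) g c.out :=
    Quotient.exact c.out_eq.symm
  rw [QuotientGroup.rightRel_apply] at h
  simpa using maassTerm_mul_left hχ hγ h τ g

/-- Left translation by `g₀⁻¹` carries the cosets for the cusp `g₀ γ h` to those for `γ`. -/
def cosetEquiv (γ : SL(2, ℤ)) (g₀ : Gamma0 N) {h : SL(2, ℤ)} (hh : h ∈ stabInfty) :
    CuspCosets N (g₀ * γ * h) ≃ CuspCosets N γ :=
  Quotient.congr (Equiv.mulLeft g₀⁻¹) fun a b => by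
    rw [QuotientGroup.rightRel_apply, QuotientGroup.rightRel_apply, mem_cuspStabilizer,
      mem_cuspStabilizer]
    change _ ∈ stabInfty ↔ _ ∈ stabInfty
    have e : ((g₀ : SL(2, ℤ)) * γ * h)⁻¹ * ((b * a⁻¹ : Gamma0 N) : SL(2, ℤ)) * (g₀ * γ * h) =
        h⁻¹ * (γ⁻¹ * ((g₀⁻¹ * b * (g₀⁻¹ * a)⁻¹ : Gamma0 N) : SL(2, ℤ)) * γ) * h := by
      push_cast; group
    rw [e, stabInfty.mul_mem_cancel_right hh, stabInfty.mul_mem_cancel_left (inv_mem hh)]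
    rfl

/-- Reindex by g ↦ g₀⁻¹ g. A unipotent h leaves lower rows unchanged, so only the factor from χ(g₀)
remains. -/
lemma maassSeries_equivalent (hχ : χ (-1) = (-1) ^ (-(m : ℤ))) (hγ : TrivialAtCusp χ γ)
    (g₀ : Gamma0 N) {h : SL(2, ℤ)} (h0 : h 1 0 = 0) (h1 : h 1 1 = 1) :
    maassSeries χ (-m) (g₀ * γ * h) =
      starRingEnd ℂ (charValue χ g₀) • maassSeries χ (-m) γ := by
  have key (τ : ℍ) (g : Gamma0 N) : maassTerm χ (-m) (g₀ * γ * h) τ g =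
      starRingEnd ℂ (charValue χ g₀) * maassTerm χ (-m) γ τ (g₀⁻¹ * g) := by
    have hi : h⁻¹ 1 0 = 0 ∧ h⁻¹ 1 1 = 1 := by
      rcases diag_of_lower_zero h0 with ⟨h2, -⟩ | ⟨-, h2⟩
      · rw [Matrix.SpecialLinearGroup.SL2_inv_expl]
        exact ⟨neg_eq_zero.2 h0, h2⟩
      · omega
    have e : ((g₀ : SL(2, ℤ)) * γ * h)⁻¹ * (g : SL(2, ℤ)) =
        h⁻¹ * (γ⁻¹ * ((g₀⁻¹ * g : Gamma0 N) : SL(2, ℤ))) := by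
      push_cast; group
    have hg : charValue χ g = charValue χ g₀ * charValue χ (g₀⁻¹ * g) := by
      rw [← charValue_mul, mul_inv_cancel_left]
    rw [maassTerm_eq, maassTerm_eq, e, mul_row_of_lower_zero hi.1, hi.2, one_smul, hg, map_mul]
    ring
  funext τ
  have hh : h ∈ stabInfty := h0
  rw [Pi.smul_apply, maassSeries, maassSeries, smul_eq_mul, ← tsum_mul_left,
    ← (cosetEquiv γ g₀ hh).tsum_eq]
  refine tsum_congr fun c => ?_
  rw [key]
  congr 1
  conv_rhs => rw [← c.out_eq]
  exact (maassTerm_out hχ hγ τ (g₀⁻¹ * c.out)).symm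

end Cosets

/-! ### Smoothness and the shadow of 𝓕_ρ -/

section Shadow

variable {m : ℕ}

lemma smooth_maassSeries (hm : 0 < m) (γ : SL(2, ℤ)) : Smooth (maassSeries χ (-m) γ) := by
  have h := contDiffOn_biSeries (x := (cosetRow : CuspCosets N γ → _)) cosetRow_ne_zero
    (a := 1) (b := m + 1) (summable_coeff_cosetRow (by omega)
    fun c => (by simpa using norm_charValue_le χ c.out :
      ‖starRingEnd ℂ (charValue χ c.out)‖ ≤ 1))
  have h2 : ContDiff ℝ ∞ fun z : ℂ => ((z.im : ℝ) : ℂ) ^ (m + 1) / (m + 1 : ℂ) :=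
    ((Complex.ofRealCLM.contDiff.comp Complex.imCLM.contDiff).pow _).div_const _
  refine (h2.contDiffOn.mul h).congr fun z hz => ?_
  rw [Function.comp_apply, ofComplex_apply_of_im_pos hz, maassSeries_eq]
  rfl

/-- The product rule for ∂/∂τ̄ with v^m removed: the first series differentiates the powers of l̄,
the second differentiates v^(m+1). They combine term by term. -/
lemma biSeries_antiderivative (hm : 0 < m) (γ : SL(2, ℤ)) {z : ℂ} (hz : 0 < z.im) :
    (z.im : ℂ) / (m + 1) * biSeries (cosetRow : CuspCosets N γ → _)
        (fun c => -((m + 1 : ℕ) : ℂ) * starRingEnd ℂ (charValue χ c.out) * cosetRow c 0)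
        1 (m + 1 + 1) z +
      Complex.I / 2 * biSeries (cosetRow : CuspCosets N γ → _)
        (fun c => starRingEnd ℂ (charValue χ c.out)) 1 (m + 1) z =
    Complex.I / 2 * ∑' c : CuspCosets N γ,
      starRingEnd ℂ (charValue χ c.out * (linForm (cosetRow c) z)⁻¹ ^ (m + 2)) := by
  have hs := summable_coeff_cosetRow (γ := γ) (n := 1 + (m + 1)) (by omega)
    fun c => (by simpa using norm_charValue_le χ c.out :
      ‖starRingEnd ℂ (charValue χ c.out)‖ ≤ 1)
  have s1 := summable_biSeries cosetRow_ne_zero hs hz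
  have s2 := summable_biSeries (a := 1) (b := m + 1 + 1) cosetRow_ne_zero
    (summable_biSeries_deriv cosetRow_ne_zero hs (-((m + 1 : ℕ) : ℂ))) hz
  rw [biSeries, biSeries, ← tsum_mul_left, ← tsum_mul_left, ← tsum_mul_left,
    ← (s2.mul_left _).tsum_add (s1.mul_left _)]
  refine tsum_congr fun c => ?_
  have hl : linForm (cosetRow c) z ≠ 0 := linForm_row_ne_zero _ hz
  have hl' : starRingEnd ℂ (linForm (cosetRow c) z) ≠ 0 := (map_ne_zero _).2 hl
  have hm1 : (m : ℂ) + 1 ≠ 0 := by exact_mod_cast m.succ_ne_zero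
  have e : linForm (cosetRow c) z = starRingEnd ℂ (linForm (cosetRow c) z) +
      2 * Complex.I * z.im * cosetRow c 0 := by
    apply Complex.ext
    · simp [linForm]
    · simp [linForm]
      ring
  rw [map_mul, map_pow, map_inv₀]
  generalize starRingEnd ℂ (linForm (cosetRow c) z) = w at *
  generalize starRingEnd ℂ (charValue χ c.out) = q at *
  generalize linForm (cosetRow c) z = y at *
  have hI : Complex.I ^ 2 = -1 := Complex.I_sq
  push_cast
  -- With y = l and w = l̄, this cancels the y⁻¹ w^(-(m+1)) parts and leaves (i/2) w^(-(m+2)).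
  have e2 : (z.im : ℂ) * cosetRow c 0 = (Complex.I / 2) * (w - y) := by
    linear_combination (Complex.I / 2) * e + ((z.im : ℂ) * cosetRow c 0) * hI
  have e3 : w⁻¹ ^ (m + 1) = w * w⁻¹ ^ (m + 2) := by
    rw [pow_succ _ (m + 1)]
    field_simp
  have e4 : (z.im : ℂ) / (m + 1) * (-(m + 1) * q * cosetRow c 0 * (y⁻¹ ^ 1 * w⁻¹ ^ (m + 1 + 1))) =
      -((z.im : ℂ) * cosetRow c 0) * (q * (y⁻¹ * w⁻¹ ^ (m + 2))) := by
    field_simp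
  rw [e4, e2, e3]
  have e5 : y * y⁻¹ = 1 := mul_inv_cancel₀ hl
  linear_combination (Complex.I / 2 * q * w⁻¹ ^ (m + 2)) * e5

lemma shadow_maassSeries (hm : 0 < m) (γ : SL(2, ℤ)) :
    shadow (-m) (maassSeries χ (-m) γ) = eisenstein (conjChar χ) (2 - (-m)) γ := by
  funext τ
  have hs := summable_coeff_cosetRow (γ := γ) (n := 1 + (m + 1)) (by omega)
    fun c => (by simpa using norm_charValue_le χ c.out :
      ‖starRingEnd ℂ (charValue χ c.out)‖ ≤ 1)
  have hB := hasFDerivAt_biSeries (x := (cosetRow : CuspCosets N γ → _)) cosetRow_ne_zero hs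
    τ.im_pos
  have hv := ((Complex.ofRealCLM.hasFDerivAt.comp (τ : ℂ) Complex.imCLM.hasFDerivAt).pow
    (m + 1)).mul_const ((m + 1 : ℂ)⁻¹)
  have hf : HasFDerivAt (𝕜 := ℝ) (maassSeries χ (-m) γ ∘ ofComplex) _ τ :=
    (hv.mul hB).congr_of_eventuallyEq <| by
      filter_upwards [isOpen_upper.mem_nhds τ.im_pos] with z hz
      rw [Function.comp_apply, ofComplex_apply_of_im_pos hz, maassSeries_eq]
      rfl
  have hd : dbar (maassSeries χ (-m) γ) τ = (τ.im : ℂ) ^ m * (Complex.I / 2 *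
      ∑' c : CuspCosets N γ,
        starRingEnd ℂ (charValue χ c.out * (linForm (cosetRow c) τ)⁻¹ ^ (m + 2))) := by
    have hm1 : (m : ℂ) + 1 ≠ 0 := by exact_mod_cast m.succ_ne_zero
    rw [← biSeries_antiderivative hm γ τ.im_pos, dbar, hf.fderiv]
    simp
    field_simp
    ring_nf
    simp
    ring
  rw [shadow, hd, eisenstein_eq, map_mul, map_mul, Complex.conj_tsum, map_pow,
    Complex.conj_ofReal, zpow_neg, zpow_natCast]
  have hv0 : (τ.im : ℂ) ^ m ≠ 0 := pow_ne_zero _ (by exact_mod_cast τ.im_ne_zero)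
  simp only [Complex.conj_conj, map_div₀, Complex.conj_I, map_ofNat]
  field_simp
  simp

end Shadow

/-! ### Classification of the cusps of Γ₀(N) and triviality of χ -/

lemma mul_T_zpow_mul_inv_apply (γ' γ : SL(2, ℤ)) (n : ℤ) :
    (γ' * ModularGroup.T ^ n * γ⁻¹) 1 0 =
        γ' 1 0 * γ 1 1 - (γ' 1 0 * n + γ' 1 1) * γ 1 0 ∧
      (γ' * ModularGroup.T ^ n * γ⁻¹) 1 1 =
        (γ' 1 0 * n + γ' 1 1) * γ 0 0 - γ' 1 0 * γ 0 1 := by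
  have h (j : Fin 2) : (γ' * ModularGroup.T ^ n * γ⁻¹) 1 j =
      γ' 1 0 * γ⁻¹.1 0 j + (γ' 1 0 * n + γ' 1 1) * γ⁻¹.1 1 j := by
    rw [Matrix.SpecialLinearGroup.coe_mul, Matrix.SpecialLinearGroup.coe_mul,
      ModularGroup.coe_T_zpow, Matrix.mul_apply]
    simp [Matrix.mul_apply, Fin.sum_univ_two]
  rw [h, h, Matrix.SpecialLinearGroup.SL2_inv_expl]
  constructor
  · change γ' 1 0 * γ 1 1 + (γ' 1 0 * n + γ' 1 1) * -γ 1 0 = _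
    ring
  · change γ' 1 0 * -γ 0 1 + (γ' 1 0 * n + γ' 1 1) * γ 0 0 = _
    ring

lemma conj_T_zpow_apply (γ : SL(2, ℤ)) (n : ℤ) :
    (γ * ModularGroup.T ^ n * γ⁻¹) 1 0 = -(γ 1 0) ^ 2 * n ∧
      (γ * ModularGroup.T ^ n * γ⁻¹) 1 1 = 1 + γ 0 0 * γ 1 0 * n := by
  have h := γ.det_coe
  rw [Matrix.det_fin_two] at h
  rw [(mul_T_zpow_mul_inv_apply γ γ n).1, (mul_T_zpow_mul_inv_apply γ γ n).2]
  constructor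
  · ring
  · linear_combination h

/-- Units modulo G lift to units modulo C, hence to integers prime to C; Bézout then completes the
column (a, C). -/
lemma exists_cusp_representative {C : ℕ} [NeZero C] {G : ℕ} (hG : G ∣ C) (u : (ZMod G)ˣ) :
    ∃ γ : SL(2, ℤ), γ 1 0 = C ∧ (γ 0 0 : ZMod G) = u := by
  obtain ⟨w, rfl⟩ := ZMod.unitsMap_surjective hG u
  have hc : IsCoprime ((w : ZMod C).val : ℤ) (C : ℤ) :=
    Nat.isCoprime_iff_coprime.2 (ZMod.val_coe_unit_coprime w)
  obtain ⟨x, y, h⟩ := hc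
  refine ⟨⟨!![((w : ZMod C).val : ℤ), -y; C, x], ?_⟩, rfl, ?_⟩
  · rw [Matrix.det_fin_two_of]
    linear_combination h
  · change ((((w : ZMod C).val : ℤ)) : ZMod G) = _
    rw [ZMod.unitsMap_val, Int.cast_natCast, ZMod.cast_eq_val]

/-- Inequivalence of the cusps `a / C` and `a' / C'`, unless `C = C'` and
`a ≡ a'` modulo `gcd(C, N / C)`. -/
lemma eq_of_equivalent [NeZero N] {C C' : ℕ} (hC : C ∣ N) (hC' : C' ∣ N) {γ γ' : SL(2, ℤ)}
    (h1 : γ 1 0 = C) (h1' : γ' 1 0 = C') {g h : SL(2, ℤ)} (hg : g ∈ Gamma0 N) (hh : h 1 0 = 0)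
    (e : γ' = g * γ * h) :
    C = C' ∧ (γ 0 0 : ZMod (C.gcd (N / C))) = (γ' 0 0 : ZMod (C.gcd (N / C))) := by
  have hC0 : (C : ℤ) ≠ 0 := by
    have := Nat.pos_of_dvd_of_pos hC (NeZero.pos N)
    omega
  obtain ⟨K, hK⟩ := hC
  have hKC : N / C = K := by
    rw [hK]; exact Nat.mul_div_cancel_left _ (by omega)
  have hN : (N : ℤ) ∣ g 1 0 := (ZMod.intCast_zmod_eq_zero_iff_dvd _ _).1 (Gamma0_mem.1 hg)
  obtain ⟨t, ht⟩ := hN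
  have hdet := g.det_coe
  rw [Matrix.det_fin_two, ht] at hdet
  have e10 : γ' 1 0 = (g 1 0 * γ 0 0 + g 1 1 * γ 1 0) * h 0 0 := by
    rw [e]
    rw [Matrix.SpecialLinearGroup.coe_mul, Matrix.SpecialLinearGroup.coe_mul]
    simp [Matrix.mul_apply, Fin.sum_univ_two, hh]
  have e00 : γ' 0 0 = (g 0 0 * γ 0 0 + g 0 1 * γ 1 0) * h 0 0 := by
    rw [e]
    rw [Matrix.SpecialLinearGroup.coe_mul, Matrix.SpecialLinearGroup.coe_mul]
    simp [Matrix.mul_apply, Fin.sum_univ_two, hh]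
  have hε : h 0 0 * h 0 0 = 1 := by
    rcases diag_of_lower_zero hh with ⟨h, -⟩ | ⟨h, -⟩ <;> rw [h] <;> rfl
  have hNK : (N : ℤ) = C * K := by rw [hK]; push_cast; ring
  rw [h1, h1', ht] at e10
  rw [h1] at e00
  generalize h 0 0 = ε at *
  generalize g 0 0 = α at *
  generalize g 0 1 = β at *
  generalize g 1 1 = D at *
  have d1 : (C : ℤ) ∣ C' := ⟨(K * t * γ 0 0 + D) * ε, by rw [e10, hNK]; ring⟩
  have d2 : (C' : ℤ) ∣ C := by
    obtain ⟨K', hK'⟩ := hC'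
    have hNK' : (N : ℤ) = C' * K' := by rw [hK']; push_cast; ring
    have e2 : (D : ℤ) * C = C' * (ε - K' * t * γ 0 0) := by
      linear_combination (-ε) * e10 - (N * t * γ 0 0 + D * C) * hε - t * γ 0 0 * hNK'
    refine ⟨α * (ε - K' * t * γ 0 0) - β * K' * t * C, ?_⟩
    linear_combination (-(C : ℤ)) * hdet + α * e2 - β * t * C * hNK'
  have hCC : C = C' := Nat.dvd_antisymm (by exact_mod_cast d1) (by exact_mod_cast d2)
  refine ⟨hCC, ?_⟩
  rw [hKC]
  have zC : ((C : ℤ) : ZMod (C.gcd K)) = 0 :=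
    (ZMod.intCast_zmod_eq_zero_iff_dvd _ _).2 (by exact_mod_cast Nat.gcd_dvd_left C K)
  have zK : ((K : ℤ) : ZMod (C.gcd K)) = 0 :=
    (ZMod.intCast_zmod_eq_zero_iff_dvd _ _).2 (by exact_mod_cast Nat.gcd_dvd_right C K)
  -- Modulo gcd(C, K) this gives D ε = 1 and the determinant gives α D = 1. Hence α = ε, and the
  -- upper entry a' = α ε a equals a.
  have e3 : 1 = (K * t * γ 0 0 + D) * ε := by
    refine mul_left_cancel₀ hC0 ?_
    rw [← hCC] at e10
    linear_combination e10 + t * γ 0 0 * ε * hNK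
  have f1 := congrArg (Int.cast : ℤ → ZMod (C.gcd K)) e3
  have f2 := congrArg (Int.cast : ℤ → ZMod (C.gcd K)) hdet
  have f3 := congrArg (Int.cast : ℤ → ZMod (C.gcd K)) e00
  have f4 := congrArg (Int.cast : ℤ → ZMod (C.gcd K)) hε
  rw [hNK] at f2
  push_cast at f1 f2 f3 f4 zC zK
  rw [zC] at f2 f3
  rw [zK] at f1
  linear_combination -f3 + (γ 0 0 : ZMod (C.gcd K)) * (-f4 - ε * ε * f2 - ε * α * f1)

lemma exists_eq_gcd_mul [NeZero N] (c : ℤ) :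
    ∃ x : ℤ, c = (Int.gcd c N : ℤ) * x ∧ IsCoprime x ((N / Int.gcd c N : ℕ) : ℤ) := by
  have h0 : 0 < Int.gcd c N := Int.gcd_pos_of_ne_zero_right _ (by exact_mod_cast NeZero.ne N)
  obtain ⟨x, y, hxy, h1, h2⟩ := Int.exists_gcd_one h0
  refine ⟨x, by rw [mul_comm]; exact h1, ?_⟩
  have hy : y = ((N / Int.gcd c N : ℕ) : ℤ) := by
    push_cast
    exact (Int.ediv_eq_of_eq_mul_left (by omega) h2).symm
  rw [← hy]
  exact Int.isCoprime_iff_gcd_eq_one.2 hxy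

/-- Every cusp is equivalent to one of the cusps `a / C` with `C ∣ N`, and the latter depends only
on `C` and on `a` modulo `gcd(C, N / C)`. -/
lemma exists_equivalent [NeZero N] (γ : SL(2, ℤ)) {C : ℕ} (hC : C = Int.gcd (γ 1 0) N) :
    ∃ u : (ZMod (C.gcd (N / C)))ˣ, ∀ γ' : SL(2, ℤ), γ' 1 0 = C →
      (γ' 0 0 : ZMod (C.gcd (N / C))) = u →
      ∃ g₀ : Gamma0 N, ∃ h : SL(2, ℤ), h 1 0 = 0 ∧ h 1 1 = 1 ∧ γ' = g₀ * γ * h := by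
  obtain ⟨x, hx, hcop⟩ := exists_eq_gcd_mul (N := N) (γ 1 0)
  rw [← hC] at hx hcop
  have hCN : C ∣ N := by
    rw [hC]; exact_mod_cast Int.gcd_dvd_right (γ 1 0) N
  have hNK : (N : ℤ) = C * (N / C : ℕ) := by exact_mod_cast (Nat.mul_div_cancel' hCN).symm
  generalize N / C = K at *
  have hdet := γ.det_coe
  rw [Matrix.det_fin_two, hx] at hdet
  have zC : ((C : ℤ) : ZMod (C.gcd K)) = 0 :=
    (ZMod.intCast_zmod_eq_zero_iff_dvd _ _).2 (by exact_mod_cast Nat.gcd_dvd_left C K)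
  have zK : ((K : ℤ) : ZMod (C.gcd K)) = 0 :=
    (ZMod.intCast_zmod_eq_zero_iff_dvd _ _).2 (by exact_mod_cast Nat.gcd_dvd_right C K)
  obtain ⟨p, q, hpq⟩ := id hcop
  have f1 := congrArg (Int.cast : ℤ → ZMod (C.gcd K)) hdet
  have f2 := congrArg (Int.cast : ℤ → ZMod (C.gcd K)) hpq
  push_cast at f1 f2 zC zK
  rw [zC] at f1
  rw [zK] at f2
  -- The label of the cusp a/(C x) is a x: a is a unit by the determinant, x because it is prime to
  -- K.
  have hu : ((γ 0 0 : ZMod (C.gcd K)) * x) * (γ 1 1 * p) = 1 := by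
    linear_combination (x * p : ZMod (C.gcd K)) * f1 + f2
  refine ⟨Units.mkOfMulEqOne _ _ hu, fun γ' h1 h2 => ?_⟩
  rw [Units.val_mkOfMulEqOne] at h2
  have hdet' := γ'.det_coe
  rw [Matrix.det_fin_two, h1] at hdet'
  have f3 := congrArg (Int.cast : ℤ → ZMod (C.gcd K)) hdet'
  push_cast at f3
  rw [zC, h2] at f3
  -- Membership of γ' T^n γ⁻¹ in Γ₀(N) means d - d' x ≡ C x n modulo K. This is solvable because
  -- gcd(C x, K) = gcd(C, K) divides the left side.
  have hdvd : ((C.gcd K : ℕ) : ℤ) ∣ γ 1 1 - γ' 1 1 * x := by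
    rw [← ZMod.intCast_zmod_eq_zero_iff_dvd]
    push_cast
    linear_combination (γ 1 1 : ZMod (C.gcd K)) * (-f3) - (-(γ' 1 1 : ZMod (C.gcd K)) * x) * f1
  have hgcd : (C.gcd K : ℤ) = Int.gcd (C * x) K := by
    have : Int.gcd (C * x) K = Int.gcd C K :=
      Int.gcd_mul_left_left_of_gcd_eq_one (Int.isCoprime_iff_gcd_eq_one.1 hcop)
    rw [this, Int.gcd_natCast_natCast]
  obtain ⟨l, hl⟩ := hdvd
  rw [hgcd, Int.gcd_eq_gcd_ab] at hl
  set s := Int.gcdA (C * x) K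
  set t := Int.gcdB (C * x) K
  have hmem : γ' * ModularGroup.T ^ (s * l) * γ⁻¹ ∈ Gamma0 N := by
    rw [Gamma0_mem, ZMod.intCast_zmod_eq_zero_iff_dvd]
    refine ⟨t * l, ?_⟩
    rw [(mul_T_zpow_mul_inv_apply _ _ _).1, h1, hx, hNK]
    linear_combination (C : ℤ) * hl
  refine ⟨⟨_, hmem⟩, ModularGroup.T ^ (-(s * l)), ?_, ?_, ?_⟩
  · rw [ModularGroup.coe_T_zpow]; rfl
  · rw [ModularGroup.coe_T_zpow]; rfl
  · simp [mul_assoc]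

lemma factorsThrough_conjChar_iff [NeZero N] (χ : DirichletCharacter ℂ N) {d : ℕ} (hd : d ∣ N) :
    (conjChar χ).FactorsThrough d ↔ ∀ x : (ZMod N)ˣ, ZMod.unitsMap hd x = 1 → χ x = 1 := by
  rw [DirichletCharacter.factorsThrough_iff_ker_unitsMap hd]
  refine forall₂_congr fun x _ => ?_
  rw [MonoidHom.mem_ker, Units.ext_iff, MulChar.coe_toUnitHom, Units.val_one]
  change starRingEnd ℂ (χ x) = 1 ↔ _
  exact map_eq_one_iff _ (starRingEnd ℂ).injective

/-- For `c = C x` and `N = C K` with `x` prime to `K`, the translations `n` with `N ∣ c² n` are the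
multiples of `K / gcd(C, K)`. -/
lemma dvd_of_dvd_sq_mul {C K C₁ K₁ G x n : ℤ} (hC : C = C₁ * G) (hK : K = K₁ * G) (hC0 : C ≠ 0)
    (hG0 : G ≠ 0) (h : IsCoprime C₁ K₁) (hx : IsCoprime x K) (hd : C * K ∣ (C * x) ^ 2 * n) :
    K₁ ∣ n := by
  have h1 : K ∣ x ^ 2 * (C * n) := by
    refine (mul_dvd_mul_iff_left hC0).1 (hd.trans (dvd_of_eq ?_))
    ring
  have h2 : K ∣ C * n := (hx.symm.pow_right (n := 2)).dvd_of_dvd_mul_left h1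
  rw [hC, hK] at h2
  have h3 : K₁ ∣ C₁ * n := by
    refine (mul_dvd_mul_iff_right hG0).1 (h2.trans (dvd_of_eq ?_))
    ring
  exact h.symm.dvd_of_dvd_mul_left h3

/-- The condition on the divisor `C = gcd(c, N)` for `χ` to be trivial at the cusp `a / c`. -/
lemma trivialAtCusp_iff [NeZero N] (χ : DirichletCharacter ℂ N) (γ : SL(2, ℤ)) {C : ℕ}
    (hC : C = Int.gcd (γ 1 0) N) :
    TrivialAtCusp χ γ ↔ C.gcd (N / C) ∣ N / (conjChar χ).conductor := by
  obtain ⟨x, hx, hcop⟩ := exists_eq_gcd_mul (N := N) (γ 1 0)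
  rw [← hC] at hx hcop
  have hCN : C ∣ N := by
    rw [hC]; exact_mod_cast Int.gcd_dvd_right (γ 1 0) N
  have hC0 : 0 < C := Nat.pos_of_dvd_of_pos hCN (NeZero.pos N)
  obtain ⟨K, hK⟩ := hCN
  have hKC : N / C = K := by
    rw [hK]; exact Nat.mul_div_cancel_left _ hC0
  rw [hKC] at hcop ⊢
  have hG0 : 0 < C.gcd K := Nat.gcd_pos_of_pos_left _ hC0
  obtain ⟨C₁, K₁, hcop1, hC1, hK1⟩ := Nat.exists_coprime C K
  generalize C.gcd K = G at *
  have hNM : N = C * K₁ * G := by rw [hK, hK1]; ring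
  have hM : C * K₁ ∣ N := ⟨G, hNM⟩
  -- As N = C K₁ G, the divisibility says that the conductor divides C K₁.
  have step : G ∣ N / (conjChar χ).conductor ↔
      ∀ x : (ZMod N)ˣ, ZMod.unitsMap hM x = 1 → χ x = 1 := by
    rw [← factorsThrough_conjChar_iff, ← DirichletCharacter.mem_conductorSet_iff,
      DirichletCharacter.mem_conductorSet_iff_conductor_dvd _ hM,
      Nat.dvd_div_iff_mul_dvd (DirichletCharacter.conductor_dvd_level _)]
    generalize (conjChar χ).conductor = d
    rw [hNM]
    exact Nat.mul_dvd_mul_iff_right hG0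
  rw [step]
  have zNK : (N : ℤ) = C * K := by rw [hK]; push_cast; ring
  have zNM : (N : ℤ) = C * K₁ * G := by rw [hNM]; push_cast; ring
  have zC : (C : ℤ) = C₁ * G := by exact_mod_cast hC1
  have zK : (K : ℤ) = K₁ * G := by exact_mod_cast hK1
  have hdet := γ.det_coe
  rw [Matrix.det_fin_two, hx] at hdet
  constructor
  · intro H u hu
    have h1 : ((C * K₁ : ℕ) : ℤ) ∣ ((u : ZMod N).val : ℤ) - 1 := by
      rw [← ZMod.intCast_zmod_eq_zero_iff_dvd]
      have h2 := congrArg Units.val hu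
      rw [ZMod.unitsMap_val, ZMod.cast_eq_val] at h2
      push_cast
      rw [h2, Units.val_one, sub_self]
    obtain ⟨s, hs⟩ := h1
    obtain ⟨p, q, hpq⟩ := hcop
    push_cast at hs
    -- The exponent makes the lower right entry 1 + C K₁ s (a d)(x p). Since a d and x p are 1
    -- modulo G, it agrees modulo N with 1 + C K₁ s, the given unit.
    obtain ⟨h10, h11⟩ := conj_T_zpow_apply γ (K₁ * (γ 1 1 * p * s))
    have hmem : γ * ModularGroup.T ^ (K₁ * (γ 1 1 * p * s)) * γ⁻¹ ∈ Gamma0 N := by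
      rw [Gamma0_mem, ZMod.intCast_zmod_eq_zero_iff_dvd, h10, hx]
      refine ⟨-(x ^ 2 * C₁ * (γ 1 1 * p * s)), ?_⟩
      rw [zNM]
      linear_combination (-(C : ℤ) * x ^ 2 * K₁ * (γ 1 1 * p * s)) * zC
    have h3 := H ⟨_, hmem⟩ ⟨K₁ * (γ 1 1 * p * s), by
      simp only [mul_assoc, inv_mul_cancel, mul_one, inv_mul_cancel_left]⟩
    rw [charValue] at h3
    have h4 : Gamma0Map N ⟨_, hmem⟩ = (u : ZMod N) := by
      change (((γ * ModularGroup.T ^ (K₁ * (γ 1 1 * p * s)) * γ⁻¹) 1 1 : ℤ) : ZMod N) = _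
      rw [h11, hx, ← ZMod.natCast_zmod_val (u : ZMod N), ← Int.cast_natCast (R := ZMod N),
        ← sub_eq_zero, ← Int.cast_sub, ZMod.intCast_zmod_eq_zero_iff_dvd]
      refine ⟨s * (γ 0 1 * C₁ * x * (1 - q * K) - q * K₁), ?_⟩
      rw [zNM]
      linear_combination -hs + (C * K₁ * s : ℤ) * (p * x * hdet + (1 + γ 0 1 * C * x) * hpq
        - q * zK + γ 0 1 * x * (1 - q * K) * zC)
    rwa [h4] at h3
  · rintro H g ⟨n, hn⟩
    have hg : (g : SL(2, ℤ)) = γ * ModularGroup.T ^ n * γ⁻¹ := by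
      rw [← hn]; group
    obtain ⟨h10, h11⟩ := conj_T_zpow_apply γ n
    have hd : (C : ℤ) * K ∣ (C * x) ^ 2 * n := by
      have := g.2
      rw [Gamma0_mem, ZMod.intCast_zmod_eq_zero_iff_dvd, hg, h10, hx, zNK, neg_mul,
        dvd_neg] at this
      exact this
    -- Since K₁ divides n, the lower right entry of g is 1 modulo C K₁.
    obtain ⟨l, hl⟩ := dvd_of_dvd_sq_mul zC zK (by omega) (by omega)
      (Nat.isCoprime_iff_coprime.2 hcop1) hcop hd
    have hu : IsUnit (Gamma0Map N g) := by
      by_contra h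
      exact charValue_ne_zero χ g (χ.map_nonunit h)
    obtain ⟨u, hu⟩ := hu
    rw [charValue, ← hu]
    refine H u (Units.ext ?_)
    have e : Gamma0Map N g = ((1 + γ 0 0 * γ 1 0 * n : ℤ) : ZMod N) := by
      rw [← h11, ← hg]; rfl
    rw [ZMod.unitsMap_val, hu, e, ZMod.cast_intCast hM, Units.val_one, Int.cast_add, Int.cast_one,
      add_eq_left, ZMod.intCast_zmod_eq_zero_iff_dvd, hx, hl]
    exact ⟨γ 0 0 * x * l, by push_cast; ring⟩

/-! ### Values of Eisenstein series at cusps and linear independence -/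

/-- The point `(n + 1) i` of the upper half-plane. -/
def vertical (n : ℕ) : ℍ := ⟨(n + 1) * Complex.I, by simp; positivity⟩

lemma coe_vertical (n : ℕ) : (vertical n : ℂ) = (n + 1) * Complex.I := rfl

lemma linForm_cocycle (h δ : SL(2, ℤ)) (τ : ℍ) :
    linForm ((h * δ).1 1) τ = linForm (h.1 1) ((δ • τ : ℍ) : ℂ) * linForm (δ.1 1) τ := by
  rw [← denom_eq_linForm, ← denom_eq_linForm, ← denom_eq_linForm, map_mul, map_mul]
  refine (denom_cocycle_σ _ _ τ).trans ?_
  simp [σ]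

lemma tendsto_inv_linForm_vertical (y : Fin 2 → ℤ) :
    Tendsto (fun n => (linForm y (vertical n))⁻¹) atTop
      (𝓝 (if y 0 = 0 then (y 1 : ℂ)⁻¹ else 0)) := by
  split_ifs with h
  · refine tendsto_const_nhds.congr fun n => ?_
    simp [linForm, h]
  · refine squeeze_zero_norm (fun n => ?_) (tendsto_one_div_add_atTop_nhds_zero_nat (𝕜 := ℝ))
    rw [norm_inv, one_div]
    refine inv_anti₀ (by positivity) ?_
    have h1 : (linForm y (vertical n)).im = y 0 * (n + 1) := by
      simp [linForm, coe_vertical]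
    have h2 : (1 : ℝ) ≤ |(y 0 : ℝ)| := by exact_mod_cast Int.one_le_abs h
    calc (n : ℝ) + 1 ≤ |(y 0 : ℝ)| * (n + 1) := le_mul_of_one_le_left (by positivity) h2
      _ = |(linForm y (vertical n)).im| := by
        rw [h1, abs_mul, abs_of_nonneg (by positivity : (0 : ℝ) ≤ n + 1)]
      _ ≤ _ := Complex.abs_im_le_norm _

/-- The lower row of `γ⁻¹ g δ`. -/
def cosetRowAt {γ : SL(2, ℤ)} (δ : SL(2, ℤ)) (c : CuspCosets N γ) : Fin 2 → ℤ :=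
  (γ⁻¹ * (c.out : SL(2, ℤ)) * δ).1 1

lemma cosetRowAt_injective {γ : SL(2, ℤ)} (δ : SL(2, ℤ)) :
    Function.Injective (cosetRowAt δ : CuspCosets N γ → Fin 2 → ℤ) := by
  intro c c' h
  refine cosetRow_injective ?_
  have e (d : CuspCosets N γ) :
      cosetRow d = Matrix.vecMul (cosetRowAt δ d) (δ⁻¹ : SL(2, ℤ)).1 := by
    rw [cosetRow, cosetRowAt, ← Matrix.mul_apply_eq_vecMul,
      ← Matrix.SpecialLinearGroup.coe_mul, mul_inv_cancel_right]
  rw [e, e, h]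

/-- The value of the Eisenstein series at the cusp `δ(i∞)`. -/
def cuspValue (χ : DirichletCharacter ℂ N) (m : ℕ) (γ δ : SL(2, ℤ)) : ℂ :=
  ∑' c : CuspCosets N γ, charValue χ c.out *
    (if cosetRowAt δ c 0 = 0 then (cosetRowAt δ c 1 : ℂ)⁻¹ else 0) ^ (m + 2)

/-- The cocycle relation moves δ into the rows. The points (n + 1) i lie in one half strip, so a
single summable majorant permits dominated convergence. -/
lemma tendsto_eisenstein {m : ℕ} (hm : 0 < m) (γ δ : SL(2, ℤ)) :
    Tendsto (fun n => (linForm (δ.1 1) (vertical n))⁻¹ ^ (m + 2) *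
      eisenstein (conjChar χ) (2 - (-m)) γ (δ • vertical n)) atTop
      (𝓝 (cuspValue χ m γ δ)) := by
  have e (n : ℕ) : (linForm (δ.1 1) (vertical n))⁻¹ ^ (m + 2) *
      eisenstein (conjChar χ) (2 - (-m)) γ (δ • vertical n) =
      ∑' c : CuspCosets N γ, charValue χ c.out *
        (linForm (cosetRowAt δ c) (vertical n))⁻¹ ^ (m + 2) := by
    rw [eisenstein_eq, ← tsum_mul_left]
    refine tsum_congr fun c => ?_
    rw [cosetRowAt, linForm_cocycle, mul_inv, mul_pow, cosetRow]
    ring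
  simp_rw [e]
  obtain ⟨r, hr, H⟩ := exists_linForm_lower_bound 1 (B := 1 / 2) (by norm_num)
  have hsum : Summable fun c : CuspCosets N γ => ‖cosetRowAt δ c‖⁻¹ ^ (m + 2) := by
    have h := EisensteinSeries.summable_one_div_norm_rpow (k := (m + 2 : ℕ))
      (by push_cast; have : (0 : ℝ) < m := by exact_mod_cast hm
          linarith)
    refine (h.comp_injective (cosetRowAt_injective (N := N) (γ := γ) δ)).congr fun c => ?_
    simp only [Function.comp_apply, Real.rpow_neg (norm_nonneg _), Real.rpow_natCast, inv_pow]
  refine tendsto_tsum_of_dominated_convergence (hsum.mul_left (r⁻¹ ^ (m + 2)))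
    (fun c => ((tendsto_inv_linForm_vertical _).pow _).const_mul _)
    (Eventually.of_forall fun n c => ?_)
  have hstrip : (vertical n : ℂ) ∈ halfStrip 1 (1 / 2) := by
    constructor
    · simp [coe_vertical]
    · simp [coe_vertical]
      have : (0 : ℝ) ≤ n := n.cast_nonneg
      linarith
  have := norm_biTerm_le hr (row_ne_zero _) (H _ hstrip (cosetRowAt δ c))
    (charValue χ c.out) (m + 2) 0
  simp only [pow_zero, mul_one, add_zero] at this
  refine this.trans ?_
  gcongr
  exact mul_le_of_le_one_left (by positivity) (norm_charValue_le χ _)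

lemma cuspValue_eq_zero {m : ℕ} {γ δ : SL(2, ℤ)}
    (h : ∀ g ∈ Gamma0 N, (γ⁻¹ * g * δ) 1 0 ≠ 0) : cuspValue χ m γ δ = 0 := by
  have e (c : CuspCosets N γ) : charValue χ c.out *
      (if cosetRowAt δ c 0 = 0 then (cosetRowAt δ c 1 : ℂ)⁻¹ else 0) ^ (m + 2) = 0 := by
    have h0 : cosetRowAt δ c 0 ≠ 0 := h _ c.out.2
    simp [h0]
  rw [cuspValue, tsum_congr e, tsum_zero]

/-- Only the trivial coset contributes. Its chosen representative need not be 1, but the relevant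
diagonal entry is ±1. -/
lemma cuspValue_self_ne_zero {m : ℕ} (γ : SL(2, ℤ)) : cuspValue χ m γ γ ≠ 0 := by
  set c₀ : CuspCosets N γ := Quotient.mk'' 1
  have key (c : CuspCosets N γ) : cosetRowAt γ c 0 = 0 ↔ c = c₀ := by
    change (γ⁻¹ * (c.out : SL(2, ℤ)) * γ) 1 0 = 0 ↔ _
    rw [← mem_cuspStabilizer, ← c.out_eq, Quotient.eq'', QuotientGroup.rightRel_apply, one_mul,
      inv_mem_iff, c.out_eq]
  rw [cuspValue, tsum_eq_single c₀ fun c hc => by rw [if_neg (mt (key c).1 hc)]; simp,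
    if_pos ((key c₀).2 rfl)]
  refine mul_ne_zero (charValue_ne_zero χ _) (pow_ne_zero _ (inv_ne_zero ?_))
  have h1 : (γ⁻¹ * (c₀.out : SL(2, ℤ)) * γ) 1 0 = 0 := (key c₀).2 rfl
  change (((γ⁻¹ * (c₀.out : SL(2, ℤ)) * γ) 1 1 : ℤ) : ℂ) ≠ 0
  rcases diag_of_lower_zero h1 with ⟨-, h⟩ | ⟨-, h⟩ <;> rw [h] <;> simp

/-- Eisenstein series at pairwise inequivalent cusps are linearly independent. -/
lemma linearIndependent_eisenstein {ι : Type*} [Fintype ι] {m : ℕ} (hm : 0 < m)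
    (γ : ι → SL(2, ℤ))
    (hγ : ∀ i j, i ≠ j → ∀ g ∈ Gamma0 N, ((γ i)⁻¹ * g * γ j) 1 0 ≠ 0) :
    LinearIndependent ℂ fun i => eisenstein (conjChar χ) (2 - (-m)) (γ i) := by
  refine Fintype.linearIndependent_iff.2 fun a ha j => ?_
  -- Evaluating the relation at the cusp of γ j kills every term but the j-th.
  have h1 := tendsto_finsetSum Finset.univ fun i _ =>
    (tendsto_eisenstein (χ := χ) hm (γ i) (γ j)).const_mul (a i)
  have h2 (n : ℕ) : ∑ i, a i * ((linForm ((γ j).1 1) (vertical n))⁻¹ ^ (m + 2) *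
      eisenstein (conjChar χ) (2 - (-m)) (γ i) (γ j • vertical n)) = 0 := by
    have h3 := congrFun ha (γ j • vertical n)
    simp only [Finset.sum_apply, Pi.smul_apply, smul_eq_mul, Pi.zero_apply] at h3
    rw [← mul_zero ((linForm ((γ j).1 1) (vertical n))⁻¹ ^ (m + 2)), ← h3, Finset.mul_sum]
    exact Finset.sum_congr rfl fun i _ => by ring
  simp_rw [h2] at h1
  have h4 := tendsto_nhds_unique h1 tendsto_const_nhds
  rw [Finset.sum_eq_single j (fun i _ hij => by rw [cuspValue_eq_zero (hγ i j hij), mul_zero])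
    (fun h => absurd (Finset.mem_univ j) h)] at h4
  exact (mul_eq_zero.1 h4).resolve_right (cuspValue_self_ne_zero (γ j))

/-! ### The shadow operator as a conjugate-linear map -/

lemma Smooth.differentiableAt {f : ℍ → ℂ} (hf : Smooth f) (τ : ℍ) :
    DifferentiableAt ℝ (f ∘ ofComplex) (τ : ℂ) :=
  (hf.differentiableOn (by simp)).differentiableAt (isOpen_upper.mem_nhds τ.im_pos)

lemma Smooth.add {f g : ℍ → ℂ} (hf : Smooth f) (hg : Smooth g) : Smooth (f + g) :=
  ContDiffOn.add hf hg

lemma Smooth.const_smul {f : ℍ → ℂ} (hf : Smooth f) (c : ℂ) : Smooth (c • f) :=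
  ContDiffOn.const_smul c hf

lemma shadow_add (k : ℤ) {f g : ℍ → ℂ} (hf : Smooth f) (hg : Smooth g) :
    shadow k (f + g) = shadow k f + shadow k g := by
  funext τ
  have e : dbar (f + g) τ = dbar f τ + dbar g τ := by
    have h : fderiv ℝ ((f + g) ∘ ofComplex) (τ : ℂ) =
        fderiv ℝ (f ∘ ofComplex) (τ : ℂ) + fderiv ℝ (g ∘ ofComplex) (τ : ℂ) :=
      fderiv_add (hf.differentiableAt τ) (hg.differentiableAt τ)
    simp only [dbar, h, add_apply]
    ring
  simp only [shadow, e, map_add, Pi.add_apply]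
  ring

lemma shadow_smul (k : ℤ) {f : ℍ → ℂ} (hf : Smooth f) (c : ℂ) :
    shadow k (c • f) = starRingEnd ℂ c • shadow k f := by
  funext τ
  have e : dbar (c • f) τ = c * dbar f τ := by
    have h : fderiv ℝ ((c • f) ∘ ofComplex) (τ : ℂ) = c • fderiv ℝ (f ∘ ofComplex) (τ : ℂ) :=
      fderiv_const_smul (hf.differentiableAt τ) c
    simp only [dbar, h, smul_apply, smul_eq_mul]
    ring
  simp only [shadow, e, map_mul, Pi.smul_apply, smul_eq_mul]
  ring

lemma smooth_of_mem_maassSpace {m : ℕ} (hm : 0 < m) {f : ℍ → ℂ} (hf : f ∈ maassSpace χ (-m)) :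
    Smooth f := by
  induction hf using Submodule.span_induction with
  | mem f hf =>
    obtain ⟨γ, -, rfl⟩ := hf
    exact smooth_maassSeries hm γ
  | zero => exact contDiffOn_const
  | add f g _ _ hf hg => exact hf.add hg
  | smul c f _ hf => exact hf.const_smul c

/-- The shadow operator as a conjugate-linear map into the Eisenstein space. -/
def shadowMap (χ : DirichletCharacter ℂ N) {m : ℕ} (hm : 0 < m) :
    maassSpace χ (-m) →ₛₗ[starRingEnd ℂ] eisensteinSpace (conjChar χ) (2 - (-m)) :=
  LinearMap.codRestrict _
    { toFun := fun f => shadow (-m) (f : ℍ → ℂ)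
      map_add' := fun f g => shadow_add _ (smooth_of_mem_maassSpace hm f.2)
        (smooth_of_mem_maassSpace hm g.2)
      map_smul' := fun c f => shadow_smul _ (smooth_of_mem_maassSpace hm f.2) c }
    fun f => by
      obtain ⟨f, hf⟩ := f
      change shadow (-m) f ∈ _
      induction hf using Submodule.span_induction with
      | mem f hf =>
        obtain ⟨γ, hγ, rfl⟩ := hf
        rw [shadow_maassSeries hm]
        refine Submodule.subset_span ⟨γ, fun g hg => ?_, rfl⟩
        rw [charValue_conjChar, hγ g hg, map_one]
      | zero =>
        convert Submodule.zero_mem _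
        simpa using shadow_smul (-m) (f := 0) contDiffOn_const 0
      | add f g hf hg h1 h2 =>
        rw [shadow_add _ (smooth_of_mem_maassSpace hm hf) (smooth_of_mem_maassSpace hm hg)]
        exact add_mem h1 h2
      | smul c f hf h =>
        rw [shadow_smul _ (smooth_of_mem_maassSpace hm hf)]
        exact Submodule.smul_mem _ _ h

lemma trivialAtCusp_conjChar {γ : SL(2, ℤ)} :
    TrivialAtCusp (conjChar χ) γ ↔ TrivialAtCusp χ γ := by
  refine forall₂_congr fun g _ => ?_
  rw [charValue_conjChar]
  exact map_eq_one_iff _ (starRingEnd ℂ).injective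

lemma shadowMap_surjective {m : ℕ} (hm : 0 < m) : Function.Surjective (shadowMap χ hm) := by
  rintro ⟨f, hf⟩
  suffices h : ∃ F : maassSpace χ (-m), (shadowMap χ hm F : ℍ → ℂ) = f by
    obtain ⟨F, hF⟩ := h
    exact ⟨F, Subtype.ext hF⟩
  induction hf using Submodule.span_induction with
  | mem f hf =>
    obtain ⟨γ, hγ, rfl⟩ := hf
    exact ⟨⟨_, Submodule.subset_span ⟨γ, trivialAtCusp_conjChar.1 hγ, rfl⟩⟩,
      shadow_maassSeries hm γ⟩
  | zero => exact ⟨0, by simp⟩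
  | add f g _ _ h1 h2 =>
    obtain ⟨F, rfl⟩ := h1
    obtain ⟨G, rfl⟩ := h2
    exact ⟨F + G, by simp⟩
  | smul c f _ h =>
    obtain ⟨F, rfl⟩ := h
    exact ⟨starRingEnd ℂ c • F, by simp⟩

/-! ### Basis of 𝓔_k^# and injectivity of the shadow map -/

/-- The divisors `C` of `N` such that `χ` is trivial at the cusps `a / C`. -/
def cuspDivisors (χ : DirichletCharacter ℂ N) : Finset ℕ :=
  N.divisors.filter fun C => C.gcd (N / C) ∣ N / (conjChar χ).conductor

/-- Labels for the inequivalent cusps at which `χ` is trivial. -/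
abbrev CuspIndex (χ : DirichletCharacter ℂ N) : Type :=
  Σ C : cuspDivisors χ, (ZMod ((C : ℕ).gcd (N / C)))ˣ

lemma pos_of_mem_cuspDivisors (C : cuspDivisors χ) : 0 < (C : ℕ) :=
  Nat.pos_of_mem_divisors (Finset.mem_filter.1 C.2).1

instance (C : cuspDivisors χ) : NeZero ((C : ℕ).gcd (N / C)) :=
  ⟨(Nat.gcd_pos_of_pos_left _ (pos_of_mem_cuspDivisors C)).ne'⟩

lemma card_cuspIndex : Fintype.card (CuspIndex χ) =
    ∑ C ∈ cuspDivisors χ, (C.gcd (N / C)).totient := by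
  rw [Fintype.card_sigma, ← Finset.sum_coe_sort (cuspDivisors χ)]
  exact Finset.sum_congr rfl fun C _ => ZMod.card_units_eq_totient _

lemma exists_gamma_cuspIndex (i : CuspIndex χ) : ∃ γ : SL(2, ℤ), γ 1 0 = ((i.1 : ℕ) : ℤ) ∧
    (γ 0 0 : ZMod ((i.1 : ℕ).gcd (N / i.1))) = i.2 :=
  haveI : NeZero (i.1 : ℕ) := ⟨(pos_of_mem_cuspDivisors i.1).ne'⟩
  exists_cusp_representative (Nat.gcd_dvd_left _ _) i.2

/-- A matrix carrying `i∞` to the cusp with a given label. -/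
def cuspRep (i : CuspIndex χ) : SL(2, ℤ) := (exists_gamma_cuspIndex i).choose

lemma cuspRep_lower (i : CuspIndex χ) : cuspRep i 1 0 = ((i.1 : ℕ) : ℤ) :=
  (exists_gamma_cuspIndex i).choose_spec.1

lemma cuspRep_upper (i : CuspIndex χ) :
    (cuspRep i 0 0 : ZMod ((i.1 : ℕ).gcd (N / i.1))) = i.2 :=
  (exists_gamma_cuspIndex i).choose_spec.2

lemma dvd_of_mem_cuspDivisors (C : cuspDivisors χ) : (C : ℕ) ∣ N :=
  Nat.dvd_of_mem_divisors (Finset.mem_filter.1 C.2).1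

lemma trivialAtCusp_cuspRep [NeZero N] (i : CuspIndex χ) : TrivialAtCusp χ (cuspRep i) := by
  refine (trivialAtCusp_iff χ _ (C := i.1) ?_).2 (Finset.mem_filter.1 i.1.2).2
  rw [cuspRep_lower, Int.gcd_natCast_natCast,
    Nat.gcd_eq_left (dvd_of_mem_cuspDivisors i.1)]

lemma cuspRep_inequivalent [NeZero N] {i j : CuspIndex χ} (hij : i ≠ j) {g : SL(2, ℤ)}
    (hg : g ∈ Gamma0 N) : ((cuspRep i)⁻¹ * g * cuspRep j) 1 0 ≠ 0 := by
  intro h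
  obtain ⟨h1, h2⟩ := eq_of_equivalent (dvd_of_mem_cuspDivisors i.1) (dvd_of_mem_cuspDivisors j.1)
    (cuspRep_lower i) (cuspRep_lower j) (inv_mem hg) h (by group)
  have h3 := cuspRep_upper i
  have h4 := cuspRep_upper j
  apply hij
  generalize cuspRep i = γ at *
  generalize cuspRep j = γ' at *
  obtain ⟨⟨C, hC⟩, u⟩ := i
  obtain ⟨⟨C', hC'⟩, u'⟩ := j
  obtain rfl : C = C' := h1
  have : u = u' := Units.ext (h3.symm.trans (h2.trans h4))
  rw [this]

/-- Any admissible γ is equivalent to a labelled representative, and the factor relating the two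
series is invertible. -/
lemma maassSpace_eq_span [NeZero N] {m : ℕ} (hχ : χ (-1) = (-1) ^ (-(m : ℤ))) :
    maassSpace χ (-m) =
      Submodule.span ℂ (Set.range fun i : CuspIndex χ => maassSeries χ (-m) (cuspRep i)) := by
  refine le_antisymm (Submodule.span_le.2 ?_) (Submodule.span_mono ?_)
  · rintro _ ⟨γ, hγ, rfl⟩
    have h1 := (trivialAtCusp_iff χ γ rfl).1 hγ
    have h2 : Int.gcd (γ 1 0) N ∈ cuspDivisors χ := Finset.mem_filter.2
      ⟨Nat.mem_divisors.2 ⟨by exact_mod_cast Int.gcd_dvd_right (γ 1 0) N, NeZero.ne N⟩, h1⟩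
    obtain ⟨u, hu⟩ := exists_equivalent (N := N) γ rfl
    let i : CuspIndex χ := ⟨⟨_, h2⟩, u⟩
    obtain ⟨g₀, h, h0, h1, e⟩ := hu (cuspRep i) (cuspRep_lower i) (cuspRep_upper i)
    have h3 := maassSeries_equivalent hχ hγ g₀ h0 h1
    rw [← e] at h3
    have h4 : maassSeries χ (-m) γ = (starRingEnd ℂ (charValue χ g₀))⁻¹ •
        maassSeries χ (-m) (cuspRep i) := by
      rw [h3, inv_smul_smul₀ ((map_ne_zero _).2 (charValue_ne_zero χ g₀))]
    rw [h4]
    exact Submodule.smul_mem _ _ (Submodule.subset_span ⟨i, rfl⟩)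
  · rintro _ ⟨i, rfl⟩
    exact ⟨cuspRep i, trivialAtCusp_cuspRep i, rfl⟩

/-- The series at the representatives of the cusps, as elements of `𝓔_k^#(N, χ)`. -/
def maassGenerator [NeZero N] (m : ℕ) (i : CuspIndex χ) : maassSpace χ (-m) :=
  ⟨maassSeries χ (-m) (cuspRep i),
    Submodule.subset_span ⟨cuspRep i, trivialAtCusp_cuspRep i, rfl⟩⟩

/-- The shadow turns the combination into one of independent Eisenstein series with conjugated
coefficients. This serves both independence of the 𝓕_ρ and injectivity. -/
lemma eq_zero_of_shadowMap_sum_eq_zero [NeZero N] {m : ℕ} (hm : 0 < m) {a : CuspIndex χ → ℂ}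
    (h : shadowMap χ hm (∑ i, a i • maassGenerator m i) = 0) (i : CuspIndex χ) : a i = 0 := by
  have hE := Fintype.linearIndependent_iff.1 (linearIndependent_eisenstein (χ := χ) hm cuspRep
    fun i j hij g hg => cuspRep_inequivalent hij hg) (fun i => starRingEnd ℂ (a i)) ?_ i
  · exact (map_eq_zero _).1 hE
  · have h1 := congrArg (Subtype.val : _ → ℍ → ℂ) h
    simp only [map_sum, map_smulₛₗ] at h1
    rw [Submodule.coe_zero, Submodule.coe_sum] at h1
    rw [← h1]
    refine Finset.sum_congr rfl fun i _ => ?_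
    rw [← shadow_maassSeries hm]
    rfl

lemma linearIndependent_maassSeries [NeZero N] {m : ℕ} (hm : 0 < m) :
    LinearIndependent ℂ fun i : CuspIndex χ => maassSeries χ (-m) (cuspRep i) := by
  refine Fintype.linearIndependent_iff.2 fun a ha =>
    eq_zero_of_shadowMap_sum_eq_zero (χ := χ) hm ?_
  rw [show ∑ i, a i • maassGenerator (χ := χ) m i = 0 from Subtype.ext ?_, map_zero]
  rw [Submodule.coe_sum]
  exact ha

lemma shadowMap_injective [NeZero N] {m : ℕ} (hm : 0 < m)
    (hχ : χ (-1) = (-1) ^ (-(m : ℤ))) : Function.Injective (shadowMap χ hm) := by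
  refine (injective_iff_map_eq_zero _).2 fun f hf => ?_
  obtain ⟨a, ha⟩ := (Submodule.mem_span_range_iff_exists_fun ℂ).1
    ((maassSpace_eq_span hχ).le f.2)
  have e : f = ∑ i, a i • maassGenerator m i := by
    refine Subtype.ext ?_
    rw [Submodule.coe_sum, ← ha]
    rfl
  rw [e] at hf ⊢
  exact Finset.sum_eq_zero fun i _ => by
    rw [eq_zero_of_shadowMap_sum_eq_zero hm hf i, zero_smul]

end HarmonicMaass
end

theorem mainTheorem3 (N : ℕ) [NeZero N] (k : ℤ) (hk : k < 0) (χ : DirichletCharacter ℂ N)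
    (hχ : χ (-1) = (-1) ^ k) :
    (∀ γ : SL(2, ℤ), HarmonicMaass.TrivialAtCusp χ γ → ∀ τ : UpperHalfPlane,
      Summable (fun c : HarmonicMaass.CuspCosets N γ => HarmonicMaass.maassTerm χ k γ τ c.out) ∧
      Summable (fun c : HarmonicMaass.CuspCosets N γ =>
        HarmonicMaass.eisensteinTerm (HarmonicMaass.conjChar χ) (2 - k) γ τ c.out)) ∧
    (∀ f ∈ HarmonicMaass.maassSpace χ k, HarmonicMaass.Smooth f) ∧
    (∃ e : HarmonicMaass.maassSpace χ k ≃ₛₗ[starRingEnd ℂ]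
        HarmonicMaass.eisensteinSpace (HarmonicMaass.conjChar χ) (2 - k),
      ∀ f : HarmonicMaass.maassSpace χ k,
        (e f : UpperHalfPlane → ℂ) = HarmonicMaass.shadow k f) ∧
    FiniteDimensional ℂ (HarmonicMaass.maassSpace χ k) ∧
    Module.finrank ℂ (HarmonicMaass.maassSpace χ k) =
      ∑ C ∈ N.divisors.filter
          (fun C => C.gcd (N / C) ∣ N / (HarmonicMaass.conjChar χ).conductor),
        (C.gcd (N / C)).totient := by
  obtain ⟨m, rfl⟩ : ∃ m : ℕ, k = -m := ⟨k.natAbs, by omega⟩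
  have hm : 0 < m := by omega
  refine ⟨fun γ _ τ => ⟨?_, ?_⟩, fun f hf => HarmonicMaass.smooth_of_mem_maassSpace hm hf,
    ⟨LinearEquiv.ofBijective (HarmonicMaass.shadowMap χ hm)
      ⟨HarmonicMaass.shadowMap_injective hm hχ, HarmonicMaass.shadowMap_surjective hm⟩,
      fun f => rfl⟩, ?_, ?_⟩
  · exact ((HarmonicMaass.summable_maass hm γ τ.im_pos).mul_left _).congr fun c =>
      (HarmonicMaass.maassTerm_eq m γ τ c.out).symm
  · exact (HarmonicMaass.summable_eisenstein hm γ τ.im_pos).congr fun c =>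
      (HarmonicMaass.eisensteinTerm_eq m γ τ c.out).symm
  · rw [HarmonicMaass.maassSpace_eq_span hχ]
    exact FiniteDimensional.span_of_finite ℂ (Set.finite_range _)
  · rw [HarmonicMaass.maassSpace_eq_span hχ,
      finrank_span_eq_card (HarmonicMaass.linearIndependent_maassSeries hm),
      HarmonicMaass.card_cuspIndex]
    rfl
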